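/- **Conventions.** A graph (in the sense of Serre) has vertices, edges $e$ with origin $o(e)$ and terminus $t(e)$, and an involution $e\mapsto\bar e\neq e$ with $t(\bar e)=o(e)$; graph homomorphisms commute with $o$, $t$ and $\bar{\ }$. A forest is a graph in which any two vertices are joined by at most one path without backtracking. In a groupoid, $g$ has source $s(g)$ and range $r(g)$, and $gh$ is defined if $s(g)=r(h)$. A groupoid $\mathcal G$ acts on a graph $F$ if there are a surjective momentum map $\varphi\colon F^0\to\mathcal G^{(0)}$ with $\varphi\circ o=\varphi\circ t$ and left actions $\mu^0,\mu^1$ of $\mathcal G$ on $F^0$ (along $\varphi$) and on $F^1$ (along $\varphi\circ o$) such that $o(ge)=g\,o(e)$, $t(ge)=g\,t(e)$. It acts without inversion if $ge\neq\bar e$ always. **Desingularization.** Let $\mathcal G$ act without inversion on a forest $F$. A desingularization consists of a connected graph $\Gamma$ with an orientation $\Gamma^1_+$ (containing exactly one of $e,\bar e$), a subtree $T\subseteq\Gamma$ containing all vertices, with a root $r$, partial sections $\sigma_v$ ($v\in\Gamma^0$) of $\varphi\colon F^0\to\mathcal G^{(0)}$ and $\sigma_e$ ($e\in\Gamma^1$)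 of $\varphi\circ o\colon F^1\to\mathcal G^{(0)}$ with $\operatorname{dom}\sigma_{\bar e}=\operatorname{dom}\sigma_e$, $\sigma_{\bar e}(x)=\overline{\sigma_e(x)}$, and families $g_e=(g_{e,x})_{x\in\operatorname{dom}\sigma_e}$ with $s(g_{e,x})=x$ for the edges $e\notin T\cup\Gamma^1_+$, such that, with $\gamma_{e,x}=g_{e,x}$ for these edges and $\gamma_{e,x}=\mathrm{id}_x$ for $e\in T^1\cup\Gamma^1_+$: * $\gamma_{e,x}\,t(\sigma_e(x))=\sigma_{t(e)}(r(\gamma_{e,x}))$ for all $e\in\Gamma^1$, $x\in\operatorname{dom}\sigma_e$, and $x\mapsto r(\gamma_{e,x})$ is a bijection from $\operatorname{dom}\sigma_e$ to $\operatorname{dom}\sigma_{t(e)}$; * $\operatorname{dom}\sigma_r=\mathcal G^{(0)}$; the $\mathcal G$-saturations of the images of the $\sigma_v$, $v\in\Gamma^0$, partition $F^0$, and those of the images of the $\sigma_e$, $e\in\Gamma^1$, partition $F^1$. Its graph of groupoids $\mathcal G(\Gamma)$ has vertex groupoids $\mathcal G_v=\mathrm{Stab}_{\mathcal G}(\sigma_v)=\{g:\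 g\,\sigma_v(s(g))=\sigma_v(r(g))\}$, edge groupoids $\mathcal G_e=\mathcal G_{\bar e}=\mathrm{Stab}_{\mathcal G}(\sigma_e)$ and monomorphisms $\alpha_e\colon\mathcal G_e\to\mathcal G_{t(e)}$, $\alpha_e(g)=\gamma_{e,r(g)}\,g\,\gamma_{e,s(g)}^{-1}$ (the inclusion if $e\in T^1\cup\Gamma^1_+$). **Fundamental groupoid and $\psi$.** Let $\phi_e=\alpha_e\circ\alpha_{\bar e}^{-1}\colon\mathcal G^{(0)}_{o(e)}\to\mathcal G^{(0)}_{t(e)}$, and for a unit $y$ of a vertex groupoid let $\tau(y)\in\mathcal G_r^{(0)}$ be its image under the composite of the $\phi_e$ along the path in $T$ to the root. The fundamental groupoid $\pi_1(\mathcal G(\Gamma))$ is the groupoid with unit space $\mathcal G_r^{(0)}$ generated by the $g\in\mathcal G_v$, $v\in\Gamma^0$ (from $\tau(s(g))$ to $\tau(r(g))$), and the pairs $(\phi_e(x),x)$, $e\in\Gamma^1$, $x\in\mathcal G^{(0)}_{o(e)}$ (from $\tau(x)$ to $\tau(\phi_e(x))$), subject to the relations of the $\mathcal G_v$, to $(\phi_e(x),x)=\mathrm{id}$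 for $e\in T^1$, and to $(\alpha_e(r(g)),\alpha_{\bar e}(r(g)))\,\alpha_{\bar e}(g)\,(\alpha_{\bar e}(s(g)),\alpha_e(s(g)))=\alpha_e(g)$ for $e\in\Gamma^1$, $g\in\mathcal G_e$. Let $\psi\colon\pi_1(\mathcal G(\Gamma))\to\mathcal G$ be the groupoid homomorphism which is the inclusion on units, with $\psi(g)=g$ for $g\in\mathcal G_v$ and $\psi((\alpha_e(z),\alpha_{\bar e}(z)))=\gamma_{e,z}\gamma_{\bar e,z}^{-1}$ for $e\in\Gamma^1$, $z\in\mathcal G_e^{(0)}$. **Bass–Serre forest.** Let $|e|$ be the element of $\{e,\bar e\}\cap\Gamma^1_+$, let $\mathcal H_{e}=\alpha_{e}(\mathcal G_{e})$, and let $\varepsilon(e)=0$ if $e\in\Gamma^1_+$, $\varepsilon(e)=1$ otherwise. The forest $X_{\mathcal G(\Gamma)}$ has as vertices the cosets $p\,\mathcal G_v[v]$ ($v\in\Gamma^0$) and as edges the cosets $p\,\mathcal H_{|e|}[e]$ ($e\in\Gamma^1$), $p\in\pi_1(\mathcal G(\Gamma))$, with $$o(p\mathcal H_{|e|}[e])=p\,e^{1-\varepsilon(e)}\mathcal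 G_{o(e)}[o(e)],\quad t(p\mathcal H_{|e|}[e])=p\,e^{-\varepsilon(e)}\mathcal G_{t(e)}[t(e)],\quad \overline{p\mathcal H_{|e|}[e]}=p\mathcal H_{|e|}[\bar e],$$ where $e$ denotes the element $(\alpha_e(z),\alpha_{\bar e}(z))$ for which the product is defined. $\pi_1(\mathcal G(\Gamma))$ acts on it by left multiplication, with momentum map $p\,\mathcal G_v[v]\mapsto r(p)$, $p\,\mathcal H_{|e|}[e]\mapsto r(p)$. **Proposition.** For every desingularization as above, the formulas $$\Psi^0(p\,\mathcal G_v[v])=\mu^0\big(\psi(p),\sigma_v(\psi(s(p)))\big),\qquad \Psi^1(p\,\mathcal H_{|e|}[e])=\mu^1\big(\psi(p),\sigma_e(\psi(s(p)))\big)$$ are well defined, and $\Psi=(\Psi^0,\Psi^1)\colon X_{\mathcal G(\Gamma)}\to F$ is a homomorphism of graphs. It is equivariant with respect to $\psi$: it is compatible with the momentum maps, and $\Psi^0(\mu^0(p,w))=\mu^0(\psi(p),\Psi^0(w))$, $\Psi^1(\mu^1(p,f))=\mu^1(\psi(p),\Psi^1(f))$ for all $p\in\pi_1(\mathcal G(\Gamma))$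 and all vertices $w$ and edges $f$ of $X_{\mathcal G(\Gamma)}$ for which the left hand side is defined. -/

import Mathlib

open CategoryTheory

universe w₁ w₂ w₃ w₄ w₅ w₆ v₁ u₁

set_option linter.checkUnivs false

noncomputable section

/-! ### Graphs in the sense of Serre -/

/-- A graph in the sense of Serre: every geometric edge is a pair `e`, `bar e` of distinct
oriented edges, with origin `o` and terminus `t`. -/
structure SerreGraph where
  Vert : Type w₁
  Edge : Type w₂
  nonempty_vert : Nonempty Vert
  o : Edge → Vert
  t : Edge → Vert
  bar : Edge → Edge
  bar_ne : ∀ e, bar e ≠ e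
  bar_bar : ∀ e, bar (bar e) = e
  t_bar : ∀ e, t (bar e) = o e

namespace SerreGraph

/-- Homomorphisms of graphs. -/
@[ext]
structure Hom (Γ : SerreGraph.{w₁, w₂}) (Λ : SerreGraph.{w₃, w₄}) where
  onVert : Γ.Vert → Λ.Vert
  onEdge : Γ.Edge → Λ.Edge
  map_o : ∀ e, onVert (Γ.o e) = Λ.o (onEdge e)
  map_t : ∀ e, onVert (Γ.t e) = Λ.t (onEdge e)
  map_bar : ∀ e, onEdge (Γ.bar e) = Λ.bar (onEdge e)

variable (Γ : SerreGraph.{w₁, w₂})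

/-- `Γ.IsPath v p w`: the list `p = e₁ ⋯ eₙ` is a path from `v` to `w`, i.e. `t(e₁) = v`,
`o(eᵢ) = t(eᵢ₊₁)` and `o(eₙ) = w`; the empty list is the path of length zero at `v = w`. -/
def IsPath : Γ.Vert → List Γ.Edge → Γ.Vert → Prop
  | v, [], w => v = w
  | v, e :: p, w => Γ.t e = v ∧ IsPath (Γ.o e) p w

/-- The set of paths from `v` to `w` without backtracking. -/
def reducedPaths (v w : Γ.Vert) : Set (List Γ.Edge) :=
  {p | Γ.IsPath v p w ∧ p.IsChain (fun e f => f ≠ Γ.bar e)}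

def Connected : Prop := ∀ v w, (Γ.reducedPaths v w).Nonempty

/-- A tree: any two vertices are joined by exactly one path without backtracking. -/
def IsTree : Prop := ∀ v w, ∃! p, p ∈ Γ.reducedPaths v w

/-- A forest: every connected component is a tree, i.e. any two vertices (of the same component)
are joined by at most one path without backtracking. -/
def IsForest : Prop := ∀ v w, (Γ.reducedPaths v w).Subsingleton

/-- The subgraph with all the vertices of `Γ` and with a set `S` of edges that is stable under
`bar`. -/
def restrict (S : Set Γ.Edge) (hS : ∀ e ∈ S, Γ.bar e ∈ S) : SerreGraph.{w₁, w₂} where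
  Vert := Γ.Vert
  Edge := S
  nonempty_vert := Γ.nonempty_vert
  o e := Γ.o e
  t e := Γ.t e
  bar e := ⟨Γ.bar e, hS e e.2⟩
  bar_ne e h := Γ.bar_ne e (congrArg Subtype.val h)
  bar_bar e := Subtype.ext (Γ.bar_bar e)
  t_bar e := Γ.t_bar e

/-- A maximal subtree of a connected graph `Γ` (that is: a subtree which contains all the vertices
of `Γ`), together with the choice of a root. -/
structure RootedMaximalSubtree where
  edges : Set Γ.Edge
  bar_mem : ∀ e ∈ edges, Γ.bar e ∈ edges
  isTree : (Γ.restrict edges bar_mem).IsTree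
  root : Γ.Vert

/-- An orientation: a set of edges which contains exactly one edge of each pair `e`, `bar e`. -/
structure Orientation where
  pos : Set Γ.Edge
  mem_iff : ∀ e, e ∈ pos ↔ Γ.bar e ∉ pos

open Classical in
/-- The edge `|e|`: the element of `{e, bar e}` which is positively oriented. -/
def Orientation.abs {Γ : SerreGraph.{w₁, w₂}} (P : Γ.Orientation) (e : Γ.Edge) : Γ.Edge :=
  if e ∈ P.pos then e else Γ.bar e

/-- Geometric edges, i.e. pairs `{e, bar e}`. -/
def GeomEdge : Type w₂ := Quot (fun e f : Γ.Edge => f = Γ.bar e)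

def geom (e : Γ.Edge) : Γ.GeomEdge := Quot.mk _ e

variable {Γ}

theorem geom_bar (e : Γ.Edge) : Γ.geom (Γ.bar e) = Γ.geom e := (Quot.sound (r := fun e f : Γ.Edge => f = Γ.bar e) rfl).symm

theorem o_bar (e : Γ.Edge) : Γ.o (Γ.bar e) = Γ.t e := by rw [← Γ.t_bar, Γ.bar_bar]

theorem Orientation.abs_of_mem (P : Γ.Orientation) {e : Γ.Edge} (h : e ∈ P.pos) :
    P.abs e = e := if_pos h

theorem Orientation.abs_of_notMem (P : Γ.Orientation) {e : Γ.Edge} (h : e ∉ P.pos) :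
    P.abs e = Γ.bar e := if_neg h

theorem Orientation.abs_bar (P : Γ.Orientation) (e : Γ.Edge) : P.abs (Γ.bar e) = P.abs e := by
  by_cases h : e ∈ P.pos
  · rw [P.abs_of_mem h, P.abs_of_notMem ((P.mem_iff e).1 h), Γ.bar_bar]
  · have h' : Γ.bar e ∈ P.pos := not_not.1 (mt (P.mem_iff e).2 h)
    rw [P.abs_of_notMem h, P.abs_of_mem h']

theorem Orientation.abs_mem (P : Γ.Orientation) (e : Γ.Edge) : P.abs e ∈ P.pos := by
  by_cases h : e ∈ P.pos
  · rwa [P.abs_of_mem h]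
  · rw [P.abs_of_notMem h]
    exact not_not.1 (mt (P.mem_iff e).2 h)

theorem Orientation.geom_abs (P : Γ.Orientation) (e : Γ.Edge) :
    Γ.geom (P.abs e) = Γ.geom e := by
  by_cases h : e ∈ P.pos
  · rw [P.abs_of_mem h]
  · rw [P.abs_of_notMem h, geom_bar]

theorem IsForest.edge_ext (h : Γ.IsForest) {e f : Γ.Edge} (ho : Γ.o e = Γ.o f)
    (ht : Γ.t e = Γ.t f) : e = f := by
  have := h (Γ.t e) (Γ.o e) (x := [e]) ⟨⟨rfl, rfl⟩, by simp⟩ (y := [f])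
    ⟨⟨ht.symm, ho.symm⟩, by simp⟩
  simpa using this

end SerreGraph

/-! ### Groupoid actions

In a groupoid, an arrow `g : x ⟶ y` has source `s(g) = x` and range `r(g) = y`; the product `g h`
(defined for `s(g) = r(h)`) is `h ≫ g`. -/

/-- A left action of a groupoid on a set, with momentum map `mom`: the element `act g a _ = g a` is
defined for `s(g) = mom a`. (Surjectivity of the momentum map is not part of this structure.) -/
structure GroupoidAction (𝒢 : Type u₁) [Groupoid.{v₁} 𝒢] (X : Type w₁) where
  mom : X → 𝒢
  act : ∀ {x y : 𝒢} (_ : x ⟶ y) (a : X), mom a = x → X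
  mom_act : ∀ {x y : 𝒢} (g : x ⟶ y) (a : X) (h : mom a = x), mom (act g a h) = y
  act_act : ∀ {x y z : 𝒢} (g : x ⟶ y) (k : y ⟶ z) (a : X) (h : mom a = x),
    act k (act g a h) (mom_act g a h) = act (g ≫ k) a h
  act_id : ∀ a : X, act (𝟙 (mom a)) a rfl = a

/-- A partial section of the momentum map of an action. -/
structure PartialSection {𝒢 : Type u₁} [Groupoid.{v₁} 𝒢] {X : Type w₁}
    (B : GroupoidAction 𝒢 X) where
  dom : Set 𝒢
  toFun : ∀ x, x ∈ dom → X
  mom_toFun : ∀ x hx, B.mom (toFun x hx) = x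

namespace GroupoidAction

variable {𝒢 : Type u₁} [Groupoid.{v₁} 𝒢] {X : Type w₁} (B : GroupoidAction 𝒢 X)

theorem act_congr {x y : 𝒢} (g : x ⟶ y) {a b : X} (e : a = b) (h : B.mom a = x) :
    B.act g a h = B.act g b (e ▸ h) := by
  subst e; rfl

theorem act_id' {x : 𝒢} (a : X) (h : B.mom a = x) : B.act (𝟙 x) a h = a := by
  subst h; exact B.act_id a

theorem act_inv {x y : 𝒢} (g : x ⟶ y) {a b : X} (h : B.mom a = x) (h' : B.mom b = y)
    (e : B.act g a h = b) : B.act (Groupoid.inv g) b h' = a := by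
  subst e
  rw [B.act_act, Groupoid.comp_inv, B.act_id']

end GroupoidAction

/-- The stabilizer of a partial section `σ`: the subgroupoid of all `g` with
`g σ(s(g)) = σ(r(g))`. -/
def PartialSection.stab {𝒢 : Type u₁} [Groupoid.{v₁} 𝒢] {X : Type w₁}
    {B : GroupoidAction 𝒢 X} (σ : PartialSection B) : Subgroupoid 𝒢 where
  arrows x y := {g | ∃ (hx : x ∈ σ.dom) (hy : y ∈ σ.dom),
    B.act g (σ.toFun x hx) (σ.mom_toFun x hx) = σ.toFun y hy}
  inv := by
    rintro x y g ⟨hx, hy, h⟩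
    exact ⟨hy, hx, B.act_inv g _ _ h⟩
  mul := by
    rintro x y z g ⟨hx, hy, h⟩ k ⟨hy', hz, h'⟩
    refine ⟨hx, hz, ?_⟩
    rw [← B.act_act, B.act_congr k h, h']

theorem PartialSection.mem_objs_iff {𝒢 : Type u₁} [Groupoid.{v₁} 𝒢] {X : Type w₁}
    {B : GroupoidAction 𝒢 X} (σ : PartialSection B) (x : 𝒢) :
    x ∈ σ.stab.objs ↔ x ∈ σ.dom :=
  ⟨fun ⟨_, h, _⟩ => h, fun h => ⟨𝟙 x, h, h, B.act_id' _ _⟩⟩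

/-- An action of a groupoid on a graph: actions on vertices and on edges, compatible with origins
and termini, with a surjective momentum map `φ : Γ⁰ → 𝒢⁽⁰⁾` with `φ ∘ o = φ ∘ t`. -/
structure GraphAction (𝒢 : Type u₁) [Groupoid.{v₁} 𝒢] (Γ : SerreGraph.{w₁, w₂}) where
  onVert : GroupoidAction 𝒢 Γ.Vert
  onEdge : GroupoidAction 𝒢 Γ.Edge
  mom_surjective : Function.Surjective onVert.mom
  mom_o : ∀ e, onVert.mom (Γ.o e) = onEdge.mom e
  mom_t : ∀ e, onVert.mom (Γ.t e) = onEdge.mom e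
  o_act : ∀ {x y : 𝒢} (g : x ⟶ y) (e : Γ.Edge) (h : onEdge.mom e = x),
    Γ.o (onEdge.act g e h) = onVert.act g (Γ.o e) ((mom_o e).trans h)
  t_act : ∀ {x y : 𝒢} (g : x ⟶ y) (e : Γ.Edge) (h : onEdge.mom e = x),
    Γ.t (onEdge.act g e h) = onVert.act g (Γ.t e) ((mom_t e).trans h)

/-- An action without inversion of edges of a groupoid on a forest. -/
structure ForestAction (𝒢 : Type u₁) [Groupoid.{v₁} 𝒢] (F : SerreGraph.{w₁, w₂})
    extends GraphAction 𝒢 F where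
  isForest : F.IsForest
  without_inversion : ∀ {x y : 𝒢} (g : x ⟶ y) (e : F.Edge) (h : onEdge.mom e = x),
    onEdge.act g e h ≠ F.bar e

namespace ForestAction

variable {𝒢 : Type u₁} [Groupoid.{v₁} 𝒢] {F : SerreGraph.{w₁, w₂}} (A : ForestAction 𝒢 F)

theorem mom_bar (e : F.Edge) : A.onEdge.mom (F.bar e) = A.onEdge.mom e := by
  rw [← A.mom_t, F.t_bar, A.mom_o]

theorem act_bar {x y : 𝒢} (g : x ⟶ y) (e : F.Edge) (h : A.onEdge.mom e = x)
    (h' : A.onEdge.mom (F.bar e) = x) :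
    A.onEdge.act g (F.bar e) h' = F.bar (A.onEdge.act g e h) := by
  apply A.isForest.edge_ext
  · rw [A.o_act, SerreGraph.o_bar (A.onEdge.act g e h), A.t_act]
    exact A.onVert.act_congr g (SerreGraph.o_bar e) _
  · rw [A.t_act, F.t_bar (A.onEdge.act g e h), A.o_act]
    exact A.onVert.act_congr g (F.t_bar e) _

end ForestAction

/-- A homomorphism of graphs which is equivariant with respect to a homomorphism (functor) `ψ` of
groupoids: it is compatible with the momentum maps, and `Ψ(p w) = ψ(p) Ψ(w)` whenever `p w` is
defined, for vertices and for edges `w`. -/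
structure IsEquivariant {𝒦 : Type w₃} [Groupoid.{w₄} 𝒦] {𝒢 : Type u₁} [Groupoid.{v₁} 𝒢]
    {Γ : SerreGraph.{w₁, w₂}} {Λ : SerreGraph.{w₅, w₆}} (ψ : 𝒦 ⥤ 𝒢)
    (B : GraphAction 𝒦 Γ) (A : GraphAction 𝒢 Λ) (Ψ : Γ.Hom Λ) : Prop where
  mom_vert : ∀ w, A.onVert.mom (Ψ.onVert w) = ψ.obj (B.onVert.mom w)
  mom_edge : ∀ f, A.onEdge.mom (Ψ.onEdge f) = ψ.obj (B.onEdge.mom f)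
  act_vert : ∀ {a b : 𝒦} (p : a ⟶ b) (w : Γ.Vert) (h : B.onVert.mom w = a),
    Ψ.onVert (B.onVert.act p w h) =
      A.onVert.act (ψ.map p) (Ψ.onVert w) ((mom_vert w).trans (congrArg ψ.obj h))
  act_edge : ∀ {a b : 𝒦} (p : a ⟶ b) (f : Γ.Edge) (h : B.onEdge.mom f = a),
    Ψ.onEdge (B.onEdge.act p f h) =
      A.onEdge.act (ψ.map p) (Ψ.onEdge f) ((mom_edge f).trans (congrArg ψ.obj h))

/-! ### Graphs of groupoids and their fundamental groupoids -/

/-- A graph of groupoids on a connected graph `Γ`: a groupoid `V v` for every vertex, a groupoid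
for every geometric edge (so that the groupoids of `e` and of `bar e` are the same), and for every
edge `e` an injective homomorphism `α e` from the groupoid of `e` to that of `t(e)`, whose image is
wide (i.e. contains all the units). -/
structure GraphOfGroupoids (Γ : SerreGraph.{w₁, w₂}) where
  connected : Γ.Connected
  V : Γ.Vert → Type u₁
  E : Γ.GeomEdge → Type u₁
  [instV : ∀ v, Groupoid.{v₁} (V v)]
  [instE : ∀ c, Groupoid.{v₁} (E c)]
  α : ∀ e : Γ.Edge, E (Γ.geom e) ⥤ V (Γ.t e)
  α_injective : ∀ e, Function.Injective (α e).obj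
  α_faithful : ∀ e, (α e).Faithful
  α_wide : ∀ e, Function.Surjective (α e).obj

namespace GraphOfGroupoids

attribute [instance] instV instE

variable {Γ : SerreGraph.{w₁, w₂}} (G : GraphOfGroupoids.{w₁, w₂, v₁, u₁} Γ)

/-- The monomorphism `α e`, with a name `c` for the geometric edge of `e` and a name `v` for its
terminus; so `α (bar e)` is also a functor from the groupoid of `e` to that of `o(e)`. -/
def mono (e : Γ.Edge) {c : Γ.GeomEdge} {v : Γ.Vert} (hc : Γ.geom e = c) (hv : Γ.t e = v) :
    G.E c ⥤ G.V v := by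
  subst hc hv
  exact G.α e

theorem mono_bijective (e : Γ.Edge) {c : Γ.GeomEdge} {v : Γ.Vert} (hc : Γ.geom e = c)
    (hv : Γ.t e = v) : Function.Bijective (G.mono e hc hv).obj := by
  subst hc hv
  exact ⟨G.α_injective e, G.α_wide e⟩

/-- The bijection `φₑ = αₑ ∘ α_{bar e}⁻¹` from the units of `𝒢_{o(e)}` to the units of
`𝒢_{t(e)}`. -/
def φ (e : Γ.Edge) : G.V (Γ.o e) ≃ G.V (Γ.t e) :=
  (Equiv.ofBijective _ (G.mono_bijective (Γ.bar e) (SerreGraph.geom_bar e) (Γ.t_bar e))).symm.trans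
    (Equiv.ofBijective _ (G.mono_bijective e rfl rfl))

/-- The disjoint union of the unit spaces of the vertex groupoids. -/
abbrev Units := Σ v, G.V v

theorem φ_mono (e : Γ.Edge) {c : Γ.GeomEdge} (hc : Γ.geom e = c) (hc' : Γ.geom (Γ.bar e) = c)
    (z : G.E c) :
    G.φ e ((G.mono (Γ.bar e) hc' (Γ.t_bar e)).obj z) = (G.mono e hc rfl).obj z := by
  subst hc
  exact congrArg (Equiv.ofBijective _ (G.mono_bijective e rfl rfl))
    (Equiv.ofBijective_symm_apply_apply _
      (G.mono_bijective (Γ.bar e) (SerreGraph.geom_bar e) (Γ.t_bar e)) z)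

theorem unit_mono_eq {e f : Γ.Edge} (h : e = f) {c : Γ.GeomEdge} {v w : Γ.Vert}
    (hc : Γ.geom e = c) (hv : Γ.t e = v) (hc' : Γ.geom f = c) (hw : Γ.t f = w) (z : G.E c) :
    (⟨v, (G.mono e hc hv).obj z⟩ : G.Units) = ⟨w, (G.mono f hc' hw).obj z⟩ := by
  subst h hv hw
  rfl

/-- `G.Phi p y x`: for a path `p = e₁ ⋯ eₙ`, the composite `Φ_p = φ_{e₁} ∘ ⋯ ∘ φ_{eₙ}` maps
the unit `y` to the unit `x`. -/
def Phi : List Γ.Edge → G.Units → G.Units → Prop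
  | [], y, x => y = x
  | e :: p, y, x => ∃ z : G.V (Γ.o e), Phi p y ⟨Γ.o e, z⟩ ∧ x = ⟨Γ.t e, G.φ e z⟩

variable (T : Γ.RootedMaximalSubtree)

/-- The equivalence relation `x ∼ y` on units: `Φ_p(y) = x` for a path `p` without backtracking
in the maximal subtree `T`. -/
def UnitRel (x y : G.Units) : Prop :=
  ∃ p ∈ (Γ.restrict T.edges T.bar_mem).reducedPaths x.1 y.1, G.Phi (p.map Subtype.val) y x

theorem exists_unitRel (y : G.Units) : ∃ x : G.V T.root, G.UnitRel T ⟨T.root, x⟩ y := by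
  obtain ⟨w, y⟩ := y
  obtain ⟨p, hp, -⟩ := T.isTree T.root w
  suffices h : ∀ (p : List T.edges) (v : Γ.Vert),
      (Γ.restrict T.edges T.bar_mem).IsPath v p w →
        ∃ x : G.V v, G.Phi (p.map Subtype.val) ⟨w, y⟩ ⟨v, x⟩ by
    obtain ⟨x, hx⟩ := h p T.root hp.1
    exact ⟨x, p, hp, hx⟩
  intro p
  induction p with
  | nil => rintro v ⟨⟩; exact ⟨y, rfl⟩
  | cons e p ih =>
    rintro v ⟨⟨⟩, h⟩
    obtain ⟨z, hz⟩ := ih _ h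
    exact ⟨G.φ e z, z, hz, rfl⟩

/-- The unit space `X` of the fundamental groupoid: the unit space of the groupoid at the root. -/
structure FundUnit where
  val : G.V T.root

/-- The map `τ` which assigns to a unit `y` its representative in the unit space of the groupoid
at the root. -/
def tau (y : G.Units) : G.FundUnit T := ⟨(G.exists_unitRel T y).choose⟩

theorem tau_rel (y : G.Units) : G.UnitRel T ⟨T.root, (G.tau T y).val⟩ y :=
  (G.exists_unitRel T y).choose_spec

/-- The generators of the fundamental groupoid, with source `a` and range `b`: the arrows `g` of
the vertex groupoids, from `τ(s(g))` to `τ(r(g))`, and the pairs `(φₑ(x), x)`, from `τ(x)` to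
`τ(φₑ(x))`. -/
inductive Gen : G.FundUnit T → G.FundUnit T → Type (max w₁ w₂ v₁ u₁)
  | vert {v : Γ.Vert} {x y : G.V v} (g : x ⟶ y) {a b : G.FundUnit T}
      (ha : G.tau T ⟨v, x⟩ = a) (hb : G.tau T ⟨v, y⟩ = b) : Gen a b
  | edge (e : Γ.Edge) (x : G.V (Γ.o e)) {a b : G.FundUnit T}
      (ha : G.tau T ⟨Γ.o e, x⟩ = a) (hb : G.tau T ⟨Γ.t e, G.φ e x⟩ = b) : Gen a b

instance : Quiver (G.FundUnit T) := ⟨G.Gen T⟩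

/-- The free groupoid on the generators. -/
abbrev FreeGpd := Quiver.FreeGroupoid (G.FundUnit T)

/-- A unit, as an object of the free groupoid. -/
def freeUnit (a : G.FundUnit T) : G.FreeGpd T := (Quiver.FreeGroupoid.of (G.FundUnit T)).obj a

def freeVert {v : Γ.Vert} {x y : G.V v} (g : x ⟶ y) {a b : G.FundUnit T}
    (ha : G.tau T ⟨v, x⟩ = a) (hb : G.tau T ⟨v, y⟩ = b) : G.freeUnit T a ⟶ G.freeUnit T b :=
  (Quiver.FreeGroupoid.of (G.FundUnit T)).map (Gen.vert g ha hb : G.Gen T a b)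

def freeEdge (e : Γ.Edge) (x : G.V (Γ.o e)) {a b : G.FundUnit T}
    (ha : G.tau T ⟨Γ.o e, x⟩ = a) (hb : G.tau T ⟨Γ.t e, G.φ e x⟩ = b) :
    G.freeUnit T a ⟶ G.freeUnit T b :=
  (Quiver.FreeGroupoid.of (G.FundUnit T)).map (Gen.edge e x ha hb : G.Gen T a b)

/-- The generator `(αₑ(z), α_{bar e}(z)) = (φₑ(x), x)`, for a unit `z` of the groupoid of `e` and
`x = α_{bar e}(z)`. -/
def freeEdge' (e : Γ.Edge) {c : Γ.GeomEdge} (hc : Γ.geom e = c) (hc' : Γ.geom (Γ.bar e) = c)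
    (z : G.E c) {a b : G.FundUnit T}
    (ha : G.tau T ⟨Γ.o e, (G.mono (Γ.bar e) hc' (Γ.t_bar e)).obj z⟩ = a)
    (hb : G.tau T ⟨Γ.t e, (G.mono e hc rfl).obj z⟩ = b) : G.freeUnit T a ⟶ G.freeUnit T b :=
  G.freeEdge T e ((G.mono (Γ.bar e) hc' (Γ.t_bar e)).obj z) ha (by rw [G.φ_mono e hc hc', hb])

/-- The defining relations of the fundamental groupoid: the relations of the vertex groupoids, the
relation `(φₑ(x), x) = id` for the edges of `T`, and the relation
`(αₑ(r(g)), α_{bar e}(r(g))) · α_{bar e}(g) · (α_{bar e}(s(g)), αₑ(s(g))) = αₑ(g)` for arrows `g` of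
edge groupoids. (For a unit `g`, the last relation says that the generators `(φₑ(x), x)` and
`(x, φₑ(x))` are inverse to each other.) -/
inductive FundRel : HomRel (G.FreeGpd T)
  | id {v : Γ.Vert} (x : G.V v) :
      FundRel (G.freeVert T (𝟙 x) rfl rfl) (𝟙 (G.freeUnit T (G.tau T ⟨v, x⟩)))
  | comp {v : Γ.Vert} {x y z : G.V v} (g : x ⟶ y) (k : y ⟶ z) :
      FundRel (G.freeVert T (g ≫ k) rfl rfl) (G.freeVert T g rfl rfl ≫ G.freeVert T k rfl rfl)
  | r1 (e : Γ.Edge) (he : e ∈ T.edges) (x : G.V (Γ.o e)) {a : G.FundUnit T}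
      (ha : G.tau T ⟨Γ.o e, x⟩ = a) (hb : G.tau T ⟨Γ.t e, G.φ e x⟩ = a) :
      FundRel (G.freeEdge T e x ha hb) (𝟙 (G.freeUnit T a))
  | r2 (e : Γ.Edge) {z z' : G.E (Γ.geom e)} (g : z ⟶ z') :
      FundRel
        (G.freeEdge' T (Γ.bar e) (SerreGraph.geom_bar e) (by rw [Γ.bar_bar]) z
            (congrArg (G.tau T) (G.unit_mono_eq (Γ.bar_bar e) _ _ rfl rfl z))
            (congrArg (G.tau T) (G.unit_mono_eq rfl _ _ (SerreGraph.geom_bar e) (Γ.t_bar e) z)) ≫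
          G.freeVert T ((G.mono (Γ.bar e) (SerreGraph.geom_bar e) (Γ.t_bar e)).map g) rfl rfl ≫
          G.freeEdge' T e rfl (SerreGraph.geom_bar e) z' rfl rfl)
        (G.freeVert T ((G.mono e rfl rfl).map g) rfl rfl)

/-- The fundamental groupoid `π₁(𝒢(Γ))`. -/
abbrev FundGpd := CategoryTheory.Quotient (G.FundRel T)

/-- The canonical functor from the free groupoid to the fundamental groupoid. -/
abbrev toFund : G.FreeGpd T ⥤ G.FundGpd T := CategoryTheory.Quotient.functor (G.FundRel T)

/-- An element of `X`, as a unit of the fundamental groupoid. -/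
abbrev fundUnit (a : G.FundUnit T) : G.FundGpd T := (G.toFund T).obj (G.freeUnit T a)

/-- The class in the fundamental groupoid of an arrow `g` of a vertex groupoid. -/
def vertArr {v : Γ.Vert} {x y : G.V v} (g : x ⟶ y) {a b : G.FundUnit T}
    (ha : G.tau T ⟨v, x⟩ = a) (hb : G.tau T ⟨v, y⟩ = b) : G.fundUnit T a ⟶ G.fundUnit T b :=
  (G.toFund T).map (G.freeVert T g ha hb)

/-- The class in the fundamental groupoid of the generator `(αₑ(z), α_{bar e}(z))`. -/
def edgeArr (e : Γ.Edge) {c : Γ.GeomEdge} (hc : Γ.geom e = c) (hc' : Γ.geom (Γ.bar e) = c)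
    (z : G.E c) {a b : G.FundUnit T}
    (ha : G.tau T ⟨Γ.o e, (G.mono (Γ.bar e) hc' (Γ.t_bar e)).obj z⟩ = a)
    (hb : G.tau T ⟨Γ.t e, (G.mono e hc rfl).obj z⟩ = b) : G.fundUnit T a ⟶ G.fundUnit T b :=
  (G.toFund T).map (G.freeEdge' T e hc hc' z ha hb)

theorem vertArr_id {v : Γ.Vert} (x : G.V v) {a : G.FundUnit T} (ha ha' : G.tau T ⟨v, x⟩ = a) :
    G.vertArr T (𝟙 x) ha ha' = 𝟙 _ := by
  subst ha
  exact (CategoryTheory.Quotient.sound _ (FundRel.id (G := G) (T := T) x)).trans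
    ((G.toFund T).map_id _)

theorem vertArr_comp {v : Γ.Vert} {x y z : G.V v} (g : x ⟶ y) (k : y ⟶ z) {a b c : G.FundUnit T}
    (ha : G.tau T ⟨v, x⟩ = a) (hb : G.tau T ⟨v, y⟩ = b) (hc : G.tau T ⟨v, z⟩ = c) :
    G.vertArr T (g ≫ k) ha hc = G.vertArr T g ha hb ≫ G.vertArr T k hb hc := by
  subst ha hb hc
  exact (CategoryTheory.Quotient.sound _ (FundRel.comp (G := G) (T := T) g k)).trans
    ((G.toFund T).map_comp _ _)

theorem vertArr_mono {e f : Γ.Edge} (hef : e = f) {c : Γ.GeomEdge} {v w : Γ.Vert}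
    (hc : Γ.geom e = c) (hv : Γ.t e = v) (hc' : Γ.geom f = c) (hw : Γ.t f = w)
    {z z' : G.E c} (k : z ⟶ z') {a b : G.FundUnit T}
    (ha : G.tau T ⟨v, (G.mono e hc hv).obj z⟩ = a)
    (hb : G.tau T ⟨v, (G.mono e hc hv).obj z'⟩ = b)
    (ha' : G.tau T ⟨w, (G.mono f hc' hw).obj z⟩ = a)
    (hb' : G.tau T ⟨w, (G.mono f hc' hw).obj z'⟩ = b) :
    G.vertArr T ((G.mono e hc hv).map k) ha hb =
      G.vertArr T ((G.mono f hc' hw).map k) ha' hb' := by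
  subst hef hv hw
  rfl

/-- The relation of edge groupoids in the fundamental groupoid. -/
theorem edgeArr_rel (e : Γ.Edge) {c : Γ.GeomEdge} (hc : Γ.geom e = c)
    (hc' : Γ.geom (Γ.bar e) = c) (hc'' : Γ.geom (Γ.bar (Γ.bar e)) = c)
    {z z' : G.E c} (g : z ⟶ z') {a a' b b' : G.FundUnit T}
    (h₁ : G.tau T ⟨Γ.o (Γ.bar e), (G.mono (Γ.bar (Γ.bar e)) hc'' (Γ.t_bar _)).obj z⟩ = a)
    (h₂ : G.tau T ⟨Γ.t (Γ.bar e), (G.mono (Γ.bar e) hc' rfl).obj z⟩ = b)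
    (h₃ : G.tau T ⟨Γ.o e, (G.mono (Γ.bar e) hc' (Γ.t_bar e)).obj z⟩ = b)
    (h₄ : G.tau T ⟨Γ.o e, (G.mono (Γ.bar e) hc' (Γ.t_bar e)).obj z'⟩ = b')
    (h₅ : G.tau T ⟨Γ.t e, (G.mono e hc rfl).obj z⟩ = a)
    (h₆ : G.tau T ⟨Γ.t e, (G.mono e hc rfl).obj z'⟩ = a') :
    G.edgeArr T (Γ.bar e) hc' hc'' z h₁ h₂ ≫
        G.vertArr T ((G.mono (Γ.bar e) hc' (Γ.t_bar e)).map g) h₃ h₄ ≫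
        G.edgeArr T e hc hc' z' h₄ h₆ =
      G.vertArr T ((G.mono e hc rfl).map g) h₅ h₆ := by
  subst hc h₃ h₄ h₅ h₆
  exact CategoryTheory.Quotient.sound _ (FundRel.r2 (G := G) (T := T) e g)

/-- The generators of `e` and `bar e` are inverse to each other. -/
theorem edgeArr_bar_comp (e : Γ.Edge) {c : Γ.GeomEdge} (hc : Γ.geom e = c)
    (hc' : Γ.geom (Γ.bar e) = c) (hc'' : Γ.geom (Γ.bar (Γ.bar e)) = c)
    (z : G.E c) {a b : G.FundUnit T}
    (h₁ : G.tau T ⟨Γ.o (Γ.bar e), (G.mono (Γ.bar (Γ.bar e)) hc'' (Γ.t_bar _)).obj z⟩ = a)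
    (h₂ : G.tau T ⟨Γ.t (Γ.bar e), (G.mono (Γ.bar e) hc' rfl).obj z⟩ = b)
    (h₄ : G.tau T ⟨Γ.o e, (G.mono (Γ.bar e) hc' (Γ.t_bar e)).obj z⟩ = b)
    (h₆ : G.tau T ⟨Γ.t e, (G.mono e hc rfl).obj z⟩ = a) :
    G.edgeArr T (Γ.bar e) hc' hc'' z h₁ h₂ ≫ G.edgeArr T e hc hc' z h₄ h₆ = 𝟙 _ := by
  have h := G.edgeArr_rel T e hc hc' hc'' (𝟙 z) h₁ h₂ h₄ h₄ h₆ h₆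
  have h' : G.vertArr T ((G.mono (Γ.bar e) hc' (Γ.t_bar e)).map (𝟙 z)) h₄ h₄ = 𝟙 _ := by
    have := G.vertArr_id T ((G.mono (Γ.bar e) hc' (Γ.t_bar e)).obj z) h₄ h₄
    rwa [← (G.mono (Γ.bar e) hc' (Γ.t_bar e)).map_id z] at this
  have h'' : G.vertArr T ((G.mono e hc rfl).map (𝟙 z)) h₆ h₆ = 𝟙 _ := by
    have := G.vertArr_id T ((G.mono e hc rfl).obj z) h₆ h₆
    rwa [← (G.mono e hc rfl).map_id z] at this
  rwa [h', h'', Category.id_comp] at h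

theorem edgeArr_congr {e f : Γ.Edge} (hef : e = f) {c : Γ.GeomEdge} (hc : Γ.geom e = c)
    (hc' : Γ.geom (Γ.bar e) = c) (kc : Γ.geom f = c) (kc' : Γ.geom (Γ.bar f) = c)
    (z : G.E c) {a b : G.FundUnit T}
    (ha : G.tau T ⟨Γ.o e, (G.mono (Γ.bar e) hc' (Γ.t_bar e)).obj z⟩ = a)
    (hb : G.tau T ⟨Γ.t e, (G.mono e hc rfl).obj z⟩ = b)
    (ka : G.tau T ⟨Γ.o f, (G.mono (Γ.bar f) kc' (Γ.t_bar f)).obj z⟩ = a)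
    (kb : G.tau T ⟨Γ.t f, (G.mono f kc rfl).obj z⟩ = b) :
    G.edgeArr T e hc hc' z ha hb = G.edgeArr T f kc kc' z ka kb := by
  subst hef
  rfl

theorem inv_edgeArr (e : Γ.Edge) {c : Γ.GeomEdge} (hc : Γ.geom e = c)
    (hc' : Γ.geom (Γ.bar e) = c) (hc'' : Γ.geom (Γ.bar (Γ.bar e)) = c)
    (z : G.E c) {a b : G.FundUnit T}
    (h₁ : G.tau T ⟨Γ.o (Γ.bar e), (G.mono (Γ.bar (Γ.bar e)) hc'' (Γ.t_bar _)).obj z⟩ = a)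
    (h₂ : G.tau T ⟨Γ.t (Γ.bar e), (G.mono (Γ.bar e) hc' rfl).obj z⟩ = b)
    (h₄ : G.tau T ⟨Γ.o e, (G.mono (Γ.bar e) hc' (Γ.t_bar e)).obj z⟩ = b)
    (h₆ : G.tau T ⟨Γ.t e, (G.mono e hc rfl).obj z⟩ = a) :
    Groupoid.inv (G.edgeArr T (Γ.bar e) hc' hc'' z h₁ h₂) = G.edgeArr T e hc hc' z h₄ h₆ := by
  rw [← Category.comp_id (Groupoid.inv _), ← Category.id_comp (G.edgeArr T e hc hc' z h₄ h₆),
    ← Groupoid.inv_comp (G.edgeArr T (Γ.bar e) hc' hc'' z h₁ h₂), Category.assoc,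
    G.edgeArr_bar_comp]

/-- The relation of edge groupoids, in the form `αₑ(g) · e = e · α_{bar e}(g)`. -/
theorem edgeArr_comm (e : Γ.Edge) {c : Γ.GeomEdge} (hc : Γ.geom e = c)
    (hc' : Γ.geom (Γ.bar e) = c) {z z' : G.E c} (g : z ⟶ z') {a a' b b' : G.FundUnit T}
    (h₃ : G.tau T ⟨Γ.o e, (G.mono (Γ.bar e) hc' (Γ.t_bar e)).obj z⟩ = b)
    (h₄ : G.tau T ⟨Γ.o e, (G.mono (Γ.bar e) hc' (Γ.t_bar e)).obj z'⟩ = b')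
    (h₅ : G.tau T ⟨Γ.t e, (G.mono e hc rfl).obj z⟩ = a)
    (h₆ : G.tau T ⟨Γ.t e, (G.mono e hc rfl).obj z'⟩ = a') :
    G.edgeArr T e hc hc' z h₃ h₅ ≫ G.vertArr T ((G.mono e hc rfl).map g) h₅ h₆ =
      G.vertArr T ((G.mono (Γ.bar e) hc' (Γ.t_bar e)).map g) h₃ h₄ ≫
        G.edgeArr T e hc hc' z' h₄ h₆ := by
  have hc'' : Γ.geom (Γ.bar (Γ.bar e)) = c := by rw [Γ.bar_bar, hc]
  have h₁ : G.tau T ⟨Γ.o (Γ.bar e), (G.mono (Γ.bar (Γ.bar e)) hc'' (Γ.t_bar _)).obj z⟩ = a :=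
    (congrArg (G.tau T) (G.unit_mono_eq (Γ.bar_bar e) _ _ hc rfl z)).trans h₅
  have h₂ : G.tau T ⟨Γ.t (Γ.bar e), (G.mono (Γ.bar e) hc' rfl).obj z⟩ = b :=
    (congrArg (G.tau T) (G.unit_mono_eq rfl _ _ hc' (Γ.t_bar e) z)).trans h₃
  rw [← G.edgeArr_rel T e hc hc' hc'' g h₁ h₂ h₃ h₄ h₅ h₆,
    ← G.inv_edgeArr T e hc hc' hc'' z h₁ h₂ h₃ h₅, ← Category.assoc, Groupoid.inv_comp,
    Category.id_comp]

/-! ### The Bass–Serre forest -/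

/-- A pair of a vertex `v` and an arrow `p : a ⟶ b` of the fundamental groupoid whose source is of
the form `τ(y)` for a unit `y` of `𝒢_v`. (As `τ` is injective on the units of `𝒢_v`, such a `y` is
unique.) -/
structure VertRep where
  v : Γ.Vert
  y : G.V v
  a : G.FundUnit T
  b : G.FundUnit T
  hs : G.tau T ⟨v, y⟩ = a
  p : G.fundUnit T a ⟶ G.fundUnit T b

/-- `p g` and `p` represent the same coset of `𝒢_v`, for `g ∈ 𝒢_v` with `r(g) = s(p)`. -/
inductive VertRel : G.VertRep T → G.VertRep T → Prop
  | mk {v : Γ.Vert} {x y : G.V v} (g : x ⟶ y) {a' a b : G.FundUnit T}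
      (hx : G.tau T ⟨v, x⟩ = a') (hy : G.tau T ⟨v, y⟩ = a)
      (p : G.fundUnit T a ⟶ G.fundUnit T b) :
      VertRel ⟨v, x, a', b, hx, G.vertArr T g hx hy ≫ p⟩ ⟨v, y, a, b, hy, p⟩

variable (P : Γ.Orientation)

/-- A pair of an edge `e` and an arrow `p : a ⟶ b` of the fundamental groupoid whose source is of
the form `τ(y)` for a unit `y` of `ℋ_{|e|} = α_{|e|}(𝒢ₑ)`; here `f` is a name for `|e|` and `y` is
given as `α_{|e|}(z)`. -/
structure EdgeRep where
  e : Γ.Edge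
  f : Γ.Edge
  hf : f = P.abs e
  z : G.E (Γ.geom f)
  a : G.FundUnit T
  b : G.FundUnit T
  hs : G.tau T ⟨Γ.t f, (G.mono f rfl rfl).obj z⟩ = a
  p : G.fundUnit T a ⟶ G.fundUnit T b

/-- `p h` and `p` represent the same coset of `ℋ_{|e|}`, for `h = α_{|e|}(k) ∈ ℋ_{|e|}` with
`r(h) = s(p)`. -/
inductive EdgeRel : G.EdgeRep T P → G.EdgeRep T P → Prop
  | mk {e f : Γ.Edge} (hf : f = P.abs e) {z z' : G.E (Γ.geom f)} (k : z ⟶ z')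
      {a' a b : G.FundUnit T}
      (hz : G.tau T ⟨Γ.t f, (G.mono f rfl rfl).obj z⟩ = a')
      (hz' : G.tau T ⟨Γ.t f, (G.mono f rfl rfl).obj z'⟩ = a)
      (p : G.fundUnit T a ⟶ G.fundUnit T b) :
      EdgeRel ⟨e, f, hf, z, a', b, hz, G.vertArr T ((G.mono f rfl rfl).map k) hz hz' ≫ p⟩
        ⟨e, f, hf, z', a, b, hz', p⟩

namespace EdgeRep

variable {G T P} (R : G.EdgeRep T P)

theorem geom_e : Γ.geom R.e = Γ.geom R.f := by rw [R.hf, P.geom_abs]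

theorem geom_bar_e : Γ.geom (Γ.bar R.e) = Γ.geom R.f := by rw [SerreGraph.geom_bar, R.geom_e]

theorem f_eq (h : R.e ∈ P.pos) : R.f = R.e := by rw [R.hf, P.abs_of_mem h]

theorem f_eq_bar (h : R.e ∉ P.pos) : R.f = Γ.bar R.e := by rw [R.hf, P.abs_of_notMem h]

theorem hs_pos (h : R.e ∈ P.pos) :
    G.tau T ⟨Γ.t R.e, (G.mono R.e R.geom_e rfl).obj R.z⟩ = R.a :=
  (congrArg (G.tau T) (G.unit_mono_eq (R.f_eq h) rfl rfl R.geom_e rfl R.z)).symm.trans R.hs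

theorem hs_neg (h : R.e ∉ P.pos) :
    G.tau T ⟨Γ.o R.e, (G.mono (Γ.bar R.e) R.geom_bar_e (Γ.t_bar R.e)).obj R.z⟩ = R.a :=
  (congrArg (G.tau T) (G.unit_mono_eq (R.f_eq_bar h) rfl rfl R.geom_bar_e _ R.z)).symm.trans R.hs

open Classical in
/-- The representative `p e^{1-ε(e)}` of the origin of an edge: it is `p e` if `e` is positively
oriented, and `p` otherwise. -/
def origin : G.VertRep T :=
  if h : R.e ∈ P.pos then
    { v := Γ.o R.e
      y := (G.mono (Γ.bar R.e) R.geom_bar_e (Γ.t_bar R.e)).obj R.z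
      a := G.tau T ⟨Γ.o R.e, (G.mono (Γ.bar R.e) R.geom_bar_e (Γ.t_bar R.e)).obj R.z⟩
      b := R.b
      hs := rfl
      p := G.edgeArr T R.e R.geom_e R.geom_bar_e R.z rfl (R.hs_pos h) ≫ R.p }
  else
    { v := Γ.o R.e
      y := (G.mono (Γ.bar R.e) R.geom_bar_e (Γ.t_bar R.e)).obj R.z
      a := R.a
      b := R.b
      hs := R.hs_neg h
      p := R.p }

open Classical in
/-- The representative `p e^{-ε(e)}` of the terminus of an edge: it is `p` if `e` is positively
oriented, and `p e⁻¹` otherwise. -/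
def terminus : G.VertRep T :=
  if h : R.e ∈ P.pos then
    { v := Γ.t R.e
      y := (G.mono R.e R.geom_e rfl).obj R.z
      a := R.a
      b := R.b
      hs := R.hs_pos h
      p := R.p }
  else
    { v := Γ.t R.e
      y := (G.mono R.e R.geom_e rfl).obj R.z
      a := G.tau T ⟨Γ.t R.e, (G.mono R.e R.geom_e rfl).obj R.z⟩
      b := R.b
      hs := rfl
      p := Groupoid.inv (G.edgeArr T R.e R.geom_e R.geom_bar_e R.z (R.hs_neg h) rfl) ≫ R.p }

/-- The representative of the reversed edge. -/
def bar : G.EdgeRep T P :=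
  { R with e := Γ.bar R.e, hf := R.hf.trans (P.abs_bar R.e).symm }

theorem origin_rel {R S : G.EdgeRep T P} (h : G.EdgeRel T P R S) :
    G.VertRel T R.origin S.origin := by
  obtain ⟨hf, k, hz, hz', p⟩ := h
  rename_i e f z z' a' a b
  by_cases he : e ∈ P.pos
  · have hc : Γ.geom e = Γ.geom f := by rw [hf, P.geom_abs]
    have hc' : Γ.geom (Γ.bar e) = Γ.geom f := by rw [SerreGraph.geom_bar, hc]
    have hfe : f = e := by rw [hf, P.abs_of_mem he]
    simp only [origin, he, dif_pos]
    rw [G.vertArr_mono T hfe rfl rfl hc rfl k hz hz'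
      ((congrArg (G.tau T) (G.unit_mono_eq hfe rfl rfl hc rfl z)).symm.trans hz)
      ((congrArg (G.tau T) (G.unit_mono_eq hfe rfl rfl hc rfl z')).symm.trans hz'),
      ← Category.assoc, G.edgeArr_comm T e hc hc' k rfl rfl _ _, Category.assoc]
    exact VertRel.mk _ _ _ _
  · have hc : Γ.geom e = Γ.geom f := by rw [hf, P.geom_abs]
    have hc' : Γ.geom (Γ.bar e) = Γ.geom f := by rw [SerreGraph.geom_bar, hc]
    have hfe : f = Γ.bar e := by rw [hf, P.abs_of_notMem he]
    simp only [origin, he, dif_neg, not_false_eq_true]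
    rw [G.vertArr_mono T hfe rfl rfl hc' (Γ.t_bar e) k hz hz'
      ((congrArg (G.tau T) (G.unit_mono_eq hfe rfl rfl hc' _ z)).symm.trans hz)
      ((congrArg (G.tau T) (G.unit_mono_eq hfe rfl rfl hc' _ z')).symm.trans hz')]
    exact VertRel.mk _ _ _ _

theorem _root_.GraphOfGroupoids.VertRep.ext' {v v' : Γ.Vert} {y : G.V v} {y' : G.V v'}
    (h : (⟨v, y⟩ : G.Units) = ⟨v', y'⟩) {a a' b : G.FundUnit T} (ha : a = a')
    {hs : G.tau T ⟨v, y⟩ = a} {hs' : G.tau T ⟨v', y'⟩ = a'}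
    {p : G.fundUnit T a ⟶ G.fundUnit T b} {p' : G.fundUnit T a' ⟶ G.fundUnit T b}
    (hp : HEq p p') : (⟨v, y, a, b, hs, p⟩ : G.VertRep T) = ⟨v', y', a', b, hs', p'⟩ := by
  cases h
  subst ha
  cases hp
  rfl

theorem terminus_bar : R.bar.terminus = R.origin := by
  have hU := G.unit_mono_eq (rfl : Γ.bar R.e = Γ.bar R.e) R.geom_bar_e rfl R.geom_bar_e
    (Γ.t_bar R.e) R.z
  by_cases he : R.e ∈ P.pos
  · have he' : R.bar.e ∉ P.pos := (P.mem_iff R.e).1 he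
    simp only [terminus, origin, he, he', dif_pos, dif_neg, not_false_eq_true]
    refine VertRep.ext' hU (congrArg (G.tau T) hU) ?_
    have key : ∀ {a' : G.FundUnit T} (hb : G.tau T ⟨Γ.t (Γ.bar R.e),
        (G.mono (Γ.bar R.e) R.geom_bar_e rfl).obj R.z⟩ = a')
        (hb' : G.tau T ⟨Γ.o R.e,
          (G.mono (Γ.bar R.e) R.geom_bar_e (Γ.t_bar R.e)).obj R.z⟩ = a'),
        HEq (Groupoid.inv (G.edgeArr T (Γ.bar R.e) R.geom_bar_e R.bar.geom_bar_e R.z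
            (R.bar.hs_neg he') hb) ≫ R.p)
          (G.edgeArr T R.e R.geom_e R.geom_bar_e R.z hb' (R.hs_pos he) ≫ R.p) := by
      intro a' hb hb'
      exact heq_of_eq (congrArg (· ≫ R.p)
        (G.inv_edgeArr T R.e R.geom_e R.geom_bar_e R.bar.geom_bar_e R.z _ hb hb' (R.hs_pos he)))
    have key' := key rfl (congrArg (G.tau T) hU).symm
    refine key'.trans ?_
    have : ∀ {a' : G.FundUnit T} (h' : G.tau T ⟨Γ.o R.e,
          (G.mono (Γ.bar R.e) R.geom_bar_e (Γ.t_bar R.e)).obj R.z⟩ = a'),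
        HEq (G.edgeArr T R.e R.geom_e R.geom_bar_e R.z h' (R.hs_pos he) ≫ R.p)
          (G.edgeArr T R.e R.geom_e R.geom_bar_e R.z rfl (R.hs_pos he) ≫ R.p) := by
      rintro a' rfl
      rfl
    exact this _
  · have he' : R.bar.e ∈ P.pos := not_not.1 (mt (P.mem_iff R.e).2 he)
    simp only [terminus, origin, he, he', dif_pos, dif_neg, not_false_eq_true]
    exact VertRep.ext' hU rfl HEq.rfl

theorem bar_bar : R.bar.bar = R := by
  obtain ⟨e, f, hf, z, a, b, hs, p⟩ := R
  simp only [bar, EdgeRep.mk.injEq, heq_eq_eq, and_true]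
  exact Γ.bar_bar e

theorem bar_rel {R S : G.EdgeRep T P} (h : G.EdgeRel T P R S) : G.EdgeRel T P R.bar S.bar := by
  obtain ⟨hf, k, hz, hz', p⟩ := h
  exact EdgeRel.mk _ k hz hz' p

theorem terminus_rel {R S : G.EdgeRep T P} (h : G.EdgeRel T P R S) :
    G.VertRel T R.terminus S.terminus := by
  rw [← R.bar_bar, ← S.bar_bar, terminus_bar, terminus_bar]
  exact origin_rel (bar_rel h)

end EdgeRep

/-- The coset `p 𝒢_v [v]`, as a vertex of the Bass–Serre forest; here `s(p) = a = τ(y)`. -/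
def vertCoset (v : Γ.Vert) (y : G.V v) {a b : G.FundUnit T} (hs : G.tau T ⟨v, y⟩ = a)
    (p : G.fundUnit T a ⟶ G.fundUnit T b) : Quot (G.VertRel T) :=
  Quot.mk _ ⟨v, y, a, b, hs, p⟩

/-- The coset `p ℋ_{|e|} [e]`, as an edge of the Bass–Serre forest; here `s(p) = a = τ(α_{|e|}(z))`.
-/
def edgeCoset (e : Γ.Edge) (z : G.E (Γ.geom (P.abs e))) {a b : G.FundUnit T}
    (hs : G.tau T ⟨Γ.t (P.abs e), (G.mono (P.abs e) rfl rfl).obj z⟩ = a)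
    (p : G.fundUnit T a ⟶ G.fundUnit T b) : Quot (G.EdgeRel T P) :=
  Quot.mk _ ⟨e, P.abs e, rfl, z, a, b, hs, p⟩

/-- The Bass–Serre forest of a graph of groupoids. Its vertices are the cosets `p 𝒢_v [v]`, its
edges the cosets `p ℋ_{|e|} [e]`, with `o(p ℋ_{|e|} [e]) = p e^{1-ε(e)} 𝒢_{o(e)} [o(e)]`,
`t(p ℋ_{|e|} [e]) = p e^{-ε(e)} 𝒢_{t(e)} [t(e)]` and reversal `p ℋ_{|e|} [e] ↦ p ℋ_{|e|} [bar e]`,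
where `ε(e) = 0` if `e` is positively oriented and `ε(e) = 1` otherwise. -/
def bassSerre [hX : Nonempty (G.FundUnit T)] : SerreGraph where
  Vert := Quot (G.VertRel T)
  Edge := Quot (G.EdgeRel T P)
  nonempty_vert := hX.elim fun x => ⟨Quot.mk _ ⟨T.root, x.val, _, _, rfl, 𝟙 _⟩⟩
  o := Quot.map EdgeRep.origin fun _ _ => EdgeRep.origin_rel
  t := Quot.map EdgeRep.terminus fun _ _ => EdgeRep.terminus_rel
  bar := Quot.map EdgeRep.bar fun _ _ => EdgeRep.bar_rel
  bar_ne := by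
    let edge : Quot (G.EdgeRel T P) → Γ.Edge := Quot.lift EdgeRep.e (by rintro _ _ ⟨⟩; rfl)
    rintro ⟨R⟩ h
    exact Γ.bar_ne R.e (congrArg edge h)
  bar_bar := by
    rintro ⟨R⟩
    exact congrArg (Quot.mk _) R.bar_bar
  t_bar := by
    rintro ⟨R⟩
    exact congrArg (Quot.mk _) R.terminus_bar

/-- An object of the fundamental groupoid, as an element of `X`. -/
def ofFund (d : G.FundGpd T) : G.FundUnit T := d.as.as

section Action

variable {G T P}

/-- The product `g p`. -/
def VertRep.mul (R : G.VertRep T) {c d : G.FundGpd T} (g : c ⟶ d)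
    (h : G.fundUnit T R.b = c) : G.VertRep T where
  v := R.v
  y := R.y
  a := R.a
  b := G.ofFund T d
  hs := R.hs
  p := R.p ≫ eqToHom h ≫ g

/-- The product `g p`. -/
def EdgeRep.mul (R : G.EdgeRep T P) {c d : G.FundGpd T} (g : c ⟶ d)
    (h : G.fundUnit T R.b = c) : G.EdgeRep T P where
  e := R.e
  f := R.f
  hf := R.hf
  z := R.z
  a := R.a
  b := G.ofFund T d
  hs := R.hs
  p := R.p ≫ eqToHom h ≫ g

theorem VertRel.mul {R S : G.VertRep T} (hRS : G.VertRel T R S) {c d : G.FundGpd T} (g : c ⟶ d)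
    (h : G.fundUnit T R.b = c) (h' : G.fundUnit T S.b = c) :
    G.VertRel T (R.mul g h) (S.mul g h') := by
  obtain ⟨k, hx, hy, p⟩ := hRS
  simp only [VertRep.mul, Category.assoc]
  exact VertRel.mk k hx hy _

theorem EdgeRel.mul {R S : G.EdgeRep T P} (hRS : G.EdgeRel T P R S) {c d : G.FundGpd T}
    (g : c ⟶ d) (h : G.fundUnit T R.b = c) (h' : G.fundUnit T S.b = c) :
    G.EdgeRel T P (R.mul g h) (S.mul g h') := by
  obtain ⟨hf, k, hx, hy, p⟩ := hRS
  simp only [EdgeRep.mul, Category.assoc]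
  exact EdgeRel.mk hf k hx hy _

theorem VertRep.mul_mul (R : G.VertRep T) {c d d' : G.FundGpd T} (g : c ⟶ d) (k : d ⟶ d')
    (h : G.fundUnit T R.b = c) : (R.mul g h).mul k rfl = R.mul (g ≫ k) h := by
  have h1 : (R.p ≫ eqToHom h ≫ g) ≫ 𝟙 d ≫ k = R.p ≫ eqToHom h ≫ g ≫ k := by
    simp only [Category.id_comp, Category.assoc]
  exact congrArg (VertRep.mk R.v R.y R.a (G.ofFund T d') R.hs) h1

theorem VertRep.mul_id (R : G.VertRep T) : R.mul (𝟙 (G.fundUnit T R.b)) rfl = R := by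
  have h1 : R.p ≫ 𝟙 _ ≫ 𝟙 (G.fundUnit T R.b) = R.p := by
    simp only [Category.comp_id]
  exact congrArg (VertRep.mk R.v R.y R.a R.b R.hs) h1

theorem EdgeRep.mul_mul (R : G.EdgeRep T P) {c d d' : G.FundGpd T} (g : c ⟶ d) (k : d ⟶ d')
    (h : G.fundUnit T R.b = c) : (R.mul g h).mul k rfl = R.mul (g ≫ k) h := by
  have h1 : (R.p ≫ eqToHom h ≫ g) ≫ 𝟙 d ≫ k = R.p ≫ eqToHom h ≫ g ≫ k := by
    simp only [Category.id_comp, Category.assoc]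
  exact congrArg (EdgeRep.mk R.e R.f R.hf R.z R.a (G.ofFund T d') R.hs) h1

theorem EdgeRep.mul_id (R : G.EdgeRep T P) : R.mul (𝟙 (G.fundUnit T R.b)) rfl = R := by
  have h1 : R.p ≫ 𝟙 _ ≫ 𝟙 (G.fundUnit T R.b) = R.p := by
    simp only [Category.comp_id]
  exact congrArg (EdgeRep.mk R.e R.f R.hf R.z R.a R.b R.hs) h1

theorem EdgeRep.origin_b (R : G.EdgeRep T P) : R.origin.b = R.b := by
  unfold EdgeRep.origin
  split <;> rfl

theorem EdgeRep.terminus_b (R : G.EdgeRep T P) : R.terminus.b = R.b := by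
  rw [← R.bar_bar, EdgeRep.terminus_bar, EdgeRep.origin_b]
  rfl

theorem EdgeRep.origin_mul (R : G.EdgeRep T P) {c d : G.FundGpd T} (g : c ⟶ d)
    (h : G.fundUnit T R.b = c) (h' : G.fundUnit T R.origin.b = c) :
    (R.mul g h).origin = R.origin.mul g h' := by
  by_cases he : R.e ∈ P.pos
  · have he' : (R.mul g h).e ∈ P.pos := he
    have h1 : ∀ (S : G.VertRep T) (hS : R.origin = S),
        R.origin.mul g h' = S.mul g (hS ▸ h') := by rintro _ rfl; rfl
    rw [h1 _ (dif_pos he)]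
    simp only [origin, he', dif_pos, VertRep.mul, Category.assoc]
    rfl
  · have he' : (R.mul g h).e ∉ P.pos := he
    have h1 : ∀ (S : G.VertRep T) (hS : R.origin = S),
        R.origin.mul g h' = S.mul g (hS ▸ h') := by rintro _ rfl; rfl
    rw [h1 _ (dif_neg he)]
    simp only [origin, he', dif_neg, not_false_eq_true, VertRep.mul]
    rfl

/-- The momentum map `p 𝒢_v [v] ↦ r(p)` on vertices. -/
def vertMom : Quot (G.VertRel T) → G.FundGpd T :=
  Quot.lift (fun R => G.fundUnit T R.b) (by rintro _ _ ⟨⟩; rfl)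

/-- The momentum map `p ℋ_{|e|} [e] ↦ r(p)` on edges. -/
def edgeMom : Quot (G.EdgeRel T P) → G.FundGpd T :=
  Quot.lift (fun R => G.fundUnit T R.b) (by rintro _ _ ⟨⟩; rfl)

/-- The action `(g, p 𝒢_v [v]) ↦ g p 𝒢_v [v]` on vertices. -/
def vertAct {c d : G.FundGpd T} (g : c ⟶ d) (w : Quot (G.VertRel T)) :
    vertMom w = c → Quot (G.VertRel T) :=
  Quot.hrecOn (motive := fun w => vertMom w = c → Quot (G.VertRel T)) w
    (fun R h => Quot.mk _ (R.mul g h)) fun R S hRS => by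
      refine Function.hfunext (by rw [show vertMom (Quot.mk _ R) = vertMom (Quot.mk _ S) from
        congrArg vertMom (Quot.sound hRS)]) fun h h' _ => heq_of_eq ?_
      exact Quot.sound (hRS.mul g h h')

/-- The action `(g, p ℋ_{|e|} [e]) ↦ g p ℋ_{|e|} [e]` on edges. -/
def edgeAct {c d : G.FundGpd T} (g : c ⟶ d) (w : Quot (G.EdgeRel T P)) :
    edgeMom w = c → Quot (G.EdgeRel T P) :=
  Quot.hrecOn (motive := fun w => edgeMom w = c → Quot (G.EdgeRel T P)) w
    (fun R h => Quot.mk _ (R.mul g h)) fun R S hRS => by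
      refine Function.hfunext (by rw [show edgeMom (Quot.mk _ R) = edgeMom (Quot.mk _ S) from
        congrArg edgeMom (Quot.sound hRS)]) fun h h' _ => heq_of_eq ?_
      exact Quot.sound (hRS.mul g h h')

end Action

theorem tau_root (x : G.V T.root) : G.tau T ⟨T.root, x⟩ = ⟨x⟩ := by
  obtain ⟨p, hp, h⟩ := G.tau_rel T ⟨T.root, x⟩
  obtain rfl : p = [] := (T.isTree T.root T.root).unique hp ⟨rfl, by simp⟩
  have h' : (⟨T.root, x⟩ : G.Units) = ⟨T.root, (G.tau T ⟨T.root, x⟩).val⟩ := h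
  generalize G.tau T ⟨T.root, x⟩ = u at h' ⊢
  obtain ⟨u⟩ := u
  cases h'
  rfl

/-- The action of the fundamental groupoid on the Bass–Serre forest by left multiplication. -/
def bassSerreAction [Nonempty (G.FundUnit T)] :
    GraphAction (G.FundGpd T) (G.bassSerre T P) where
  onVert :=
    { mom := vertMom
      act := vertAct
      mom_act := by rintro x y g ⟨R⟩ h; rfl
      act_act := by
        rintro x y z g k ⟨R⟩ h
        exact congrArg (Quot.mk _) (R.mul_mul g k h)
      act_id := by
        rintro ⟨R⟩
        exact congrArg (Quot.mk _) R.mul_id }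
  onEdge :=
    { mom := edgeMom
      act := edgeAct
      mom_act := by rintro x y g ⟨R⟩ h; rfl
      act_act := by
        rintro x y z g k ⟨R⟩ h
        exact congrArg (Quot.mk _) (R.mul_mul g k h)
      act_id := by
        rintro ⟨R⟩
        exact congrArg (Quot.mk _) R.mul_id }
  mom_surjective b :=
    ⟨Quot.mk _ ⟨T.root, (G.ofFund T b).val, _, _, G.tau_root T _, 𝟙 _⟩, rfl⟩
  mom_o := by
    rintro ⟨R⟩
    exact congrArg (G.fundUnit T) R.origin_b
  mom_t := by
    rintro ⟨R⟩
    exact congrArg (G.fundUnit T) R.terminus_b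
  o_act := by
    rintro x y g ⟨R⟩ h
    exact congrArg (Quot.mk _) (R.origin_mul g h _)
  t_act := by
    rintro x y g ⟨R⟩ h
    have h' : G.fundUnit T R.bar.origin.b = x := (congrArg (G.fundUnit T) R.bar.origin_b).trans h
    have h1 : ∀ (S : G.VertRep T) (hS : S = R.terminus) (k : G.fundUnit T S.b = x),
        S.mul g k = R.terminus.mul g (hS ▸ k) := by rintro _ rfl _; rfl
    have h2 := R.bar.origin_mul g h h'
    have h3 : R.bar.origin = R.terminus := by rw [← EdgeRep.terminus_bar, R.bar_bar]
    have h4 : (R.mul g h).terminus = (R.bar.mul g h).origin := by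
      rw [← EdgeRep.terminus_bar]
      congr 1
      exact (R.mul g h).bar_bar.symm
    exact congrArg (Quot.mk _) (h4.trans (h2.trans (h1 _ h3 _)))

end GraphOfGroupoids

/-! ### Desingularizations -/

/-- A desingularization of an action without inversion of a groupoid `𝒢` on a forest `F`.

It consists of a connected graph `Γ` with an orientation and a rooted maximal subtree `T`, of a
partial section `σ v` of `F⁰` for every vertex `v` and a partial section `σE e` of `F¹` for every
edge `e` (with `σE (bar e)` the reversal of `σE e`), and of families `conj e` of elements
`conj e x` of `𝒢`, with source `x` and range `(conj e x).1`, for the units `x` in the domain of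
`σE e`. The groupoids of the associated graph of groupoids are the stabilizers of the partial
sections, and the monomorphism `α e` from the groupoid of `e` to that of `t(e)` is the conjugation
by the family `conj e`, which is trivial (i.e. `α e` is an inclusion) if `e` belongs to `T` or is
positively oriented. For the other edges `conj e` is the family usually called `g_e`. -/
structure Desingularization {𝒢 : Type u₁} [Groupoid.{v₁} 𝒢] {F : SerreGraph.{w₃, w₄}}
    (A : ForestAction 𝒢 F) where
  Γ : SerreGraph.{w₁, w₂}
  connected : Γ.Connected
  P : Γ.Orientation
  T : Γ.RootedMaximalSubtree
  σ : Γ.Vert → PartialSection A.onVert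
  σE : Γ.Edge → PartialSection A.onEdge
  conj : ∀ (e : Γ.Edge) (x : 𝒢), x ∈ (σE e).dom → Σ y : 𝒢, (x ⟶ y)
  dom_bar : ∀ e, (σE (Γ.bar e)).dom = (σE e).dom
  σE_bar : ∀ e x (hx : x ∈ (σE e).dom) (hx' : x ∈ (σE (Γ.bar e)).dom),
    (σE (Γ.bar e)).toFun x hx' = F.bar ((σE e).toFun x hx)
  conj_trivial : ∀ e, e ∈ T.edges ∨ e ∈ P.pos → ∀ x hx, conj e x hx = ⟨x, 𝟙 x⟩
  /-- `conj e x` maps the terminus of `σE e x` into the image of `σ (t e)`. -/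
  conj_mem : ∀ e x hx, (conj e x hx).1 ∈ (σ (Γ.t e)).dom
  conj_act : ∀ e x hx,
    A.onVert.act (conj e x hx).2 (F.t ((σE e).toFun x hx))
        ((A.mom_t _).trans ((σE e).mom_toFun x hx)) =
      (σ (Γ.t e)).toFun (conj e x hx).1 (conj_mem e x hx)
  /-- The conjugation is injective on units, -/
  conj_injective : ∀ e x hx x' hx', (conj e x hx).1 = (conj e x' hx').1 → x = x'
  /-- and its image is wide. -/
  conj_wide : ∀ e, ∀ y ∈ (σ (Γ.t e)).dom, ∃ x hx, (conj e x hx).1 = y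
  /-- The units of the groupoid at the root are all the units of `𝒢`. -/
  dom_root : (σ T.root).dom = Set.univ
  /-- The saturations of the images of the sections `σ v` form a partition of `F⁰`. -/
  vert_partition : ∀ w : F.Vert, ∃! v : Γ.Vert, ∃ (x : 𝒢) (hx : x ∈ (σ v).dom)
    (g : x ⟶ A.onVert.mom w), A.onVert.act g ((σ v).toFun x hx) ((σ v).mom_toFun x hx) = w
  /-- The saturations of the images of the sections `σE e` form a partition of `F¹`. -/
  edge_partition : ∀ f : F.Edge, ∃! e : Γ.Edge, ∃ (x : 𝒢) (hx : x ∈ (σE e).dom)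
    (g : x ⟶ A.onEdge.mom f), A.onEdge.act g ((σE e).toFun x hx) ((σE e).mom_toFun x hx) = f

namespace Desingularization

variable {𝒢 : Type u₁} [Groupoid.{v₁} 𝒢] {F : SerreGraph.{w₃, w₄}} {A : ForestAction 𝒢 F}
  (D : Desingularization.{w₁, w₂} A)

theorem stab_bar_le (e : D.Γ.Edge) {x y : 𝒢} (g : x ⟶ y) (h : g ∈ (D.σE e).stab.arrows x y) :
    g ∈ (D.σE (D.Γ.bar e)).stab.arrows x y := by
  obtain ⟨hx, hy, h⟩ := h
  have hx' : x ∈ (D.σE (D.Γ.bar e)).dom := by rw [D.dom_bar]; exact hx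
  have hy' : y ∈ (D.σE (D.Γ.bar e)).dom := by rw [D.dom_bar]; exact hy
  refine ⟨hx', hy', ?_⟩
  rw [D.σE_bar e y hy, ← h, A.onEdge.act_congr g (D.σE_bar e x hx hx'),
    A.act_bar g _ ((D.σE e).mom_toFun x hx)]

theorem stab_bar (e : D.Γ.Edge) : (D.σE (D.Γ.bar e)).stab = (D.σE e).stab := by
  ext x y g
  refine ⟨fun h => ?_, D.stab_bar_le e g⟩
  have := D.stab_bar_le (D.Γ.bar e) g h
  rwa [D.Γ.bar_bar] at this

/-- The groupoid of an edge `e`: the stabilizer of `σE e`. -/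
def edgeStab : D.Γ.GeomEdge → Subgroupoid 𝒢 :=
  Quot.lift (fun e => (D.σE e).stab) (by rintro e _ rfl; exact (D.stab_bar e).symm)

theorem conj_stab (e : D.Γ.Edge) {x y : 𝒢} (hx : x ∈ (D.σE e).dom) (hy : y ∈ (D.σE e).dom)
    (g : x ⟶ y) (hg : g ∈ (D.σE e).stab.arrows x y) :
    Groupoid.inv (D.conj e x hx).2 ≫ g ≫ (D.conj e y hy).2 ∈
      (D.σ (D.Γ.t e)).stab.arrows (D.conj e x hx).1 (D.conj e y hy).1 := by
  obtain ⟨_, _, h⟩ := hg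
  refine ⟨D.conj_mem e x hx, D.conj_mem e y hy, ?_⟩
  have h1 := A.onVert.act_inv _ _ ((D.σ (D.Γ.t e)).mom_toFun _ (D.conj_mem e x hx))
    (D.conj_act e x hx)
  rw [← A.onVert.act_act, A.onVert.act_congr _ h1, ← A.onVert.act_act]
  have h2 := A.t_act g _ ((D.σE e).mom_toFun x hx)
  rw [A.onVert.act_congr _ (h2.symm.trans (congrArg F.t h)), D.conj_act]

/-- The graph of groupoids of a desingularization: the groupoids are the stabilizers of the partial
sections, and the monomorphisms are the conjugations by the families `conj e`. -/
def graphOfGroupoids : GraphOfGroupoids.{w₁, w₂, v₁, u₁} D.Γ where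
  connected := D.connected
  V v := (D.σ v).stab.objs
  E c := (D.edgeStab c).objs
  α e :=
    { obj := fun z : (D.σE e).stab.objs =>
        ⟨(D.conj e z.1 (((D.σE e).mem_objs_iff z.1).1 z.2)).1,
          ((D.σ _).mem_objs_iff _).2 (D.conj_mem e _ _)⟩
      map := fun {z z' : (D.σE e).stab.objs} (g : z ⟶ z') =>
        ⟨Groupoid.inv (D.conj e z.1 (((D.σE e).mem_objs_iff z.1).1 z.2)).2 ≫ g.1 ≫
          (D.conj e z'.1 (((D.σE e).mem_objs_iff z'.1).1 z'.2)).2,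
          D.conj_stab e _ _ g.1 g.2⟩
      map_id := fun z => Subtype.ext (by
        change Groupoid.inv _ ≫ 𝟙 _ ≫ _ = 𝟙 _
        rw [Category.id_comp, Groupoid.inv_comp])
      map_comp := fun {x y z} g k => Subtype.ext (by
        change Groupoid.inv _ ≫ (g.1 ≫ k.1) ≫ _ =
          (Groupoid.inv _ ≫ g.1 ≫ _) ≫ (Groupoid.inv _ ≫ k.1 ≫ _)
        simp) }
  α_injective e := by
    intro z z' h
    exact Subtype.ext (D.conj_injective e _ _ _ _ (congrArg Subtype.val h))
  α_faithful e := by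
    constructor
    intro z z' g k h
    have h' := congrArg Subtype.val h
    change Groupoid.inv _ ≫ g.1 ≫ _ = Groupoid.inv _ ≫ k.1 ≫ _ at h'
    refine Subtype.ext ?_
    exact (cancel_mono _).1 ((cancel_epi _).1 h')
  α_wide e := by
    rintro ⟨y, hy⟩
    obtain ⟨x, hx, h⟩ := D.conj_wide e y (((D.σ _).mem_objs_iff y).1 hy)
    exact ⟨(⟨x, ((D.σE e).mem_objs_iff x).2 hx⟩ : (D.σE e).stab.objs), Subtype.ext h⟩

/-- The units of a vertex groupoid, as units of `𝒢`. -/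
def unitVal (y : D.graphOfGroupoids.Units) : 𝒢 := y.2.1

/-- The arrows of a vertex groupoid, as arrows of `𝒢`. -/
def vertVal {v : D.Γ.Vert} {x y : D.graphOfGroupoids.V v} (g : x ⟶ y) :
    D.unitVal ⟨v, x⟩ ⟶ D.unitVal ⟨v, y⟩ := g.1

theorem mem_dom {v : D.Γ.Vert} (x : D.graphOfGroupoids.V v) : D.unitVal ⟨v, x⟩ ∈ (D.σ v).dom :=
  ((D.σ v).mem_objs_iff _).1 x.2

/-- The units of an edge groupoid, as units of `𝒢`. -/
def edgeUnitVal {c : D.Γ.GeomEdge} (z : D.graphOfGroupoids.E c) : 𝒢 := z.1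

/-- The arrows of an edge groupoid, as arrows of `𝒢`. -/
def edgeVal {c : D.Γ.GeomEdge} {z z' : D.graphOfGroupoids.E c} (k : z ⟶ z') :
    D.edgeUnitVal z ⟶ D.edgeUnitVal z' := k.1

theorem mem_domE (e : D.Γ.Edge) {c : D.Γ.GeomEdge} (hc : D.Γ.geom e = c)
    (z : D.graphOfGroupoids.E c) : D.edgeUnitVal z ∈ (D.σE e).dom := by
  subst hc
  exact ((D.σE e).mem_objs_iff _).1 z.2

theorem unitVal_mono (e : D.Γ.Edge) {c : D.Γ.GeomEdge} {v : D.Γ.Vert} (hc : D.Γ.geom e = c)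
    (hv : D.Γ.t e = v) (z : D.graphOfGroupoids.E c) :
    D.unitVal ⟨v, (D.graphOfGroupoids.mono e hc hv).obj z⟩ =
      (D.conj e (D.edgeUnitVal z) (D.mem_domE e hc z)).1 := by
  subst hc hv
  rfl

/-- The element of the family `conj e` at the unit `z`, from `z` to `α e z`. -/
def conjElt (e : D.Γ.Edge) {c : D.Γ.GeomEdge} {v : D.Γ.Vert} (hc : D.Γ.geom e = c)
    (hv : D.Γ.t e = v) (z : D.graphOfGroupoids.E c) :
    D.edgeUnitVal z ⟶ D.unitVal ⟨v, (D.graphOfGroupoids.mono e hc hv).obj z⟩ :=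
  (D.conj e (D.edgeUnitVal z) (D.mem_domE e hc z)).2 ≫ eqToHom (D.unitVal_mono e hc hv z).symm

theorem vertVal_mono (e : D.Γ.Edge) {c : D.Γ.GeomEdge} {v : D.Γ.Vert} (hc : D.Γ.geom e = c)
    (hv : D.Γ.t e = v) {z z' : D.graphOfGroupoids.E c} (k : z ⟶ z') :
    D.vertVal ((D.graphOfGroupoids.mono e hc hv).map k) =
      Groupoid.inv (D.conjElt e hc hv z) ≫ D.edgeVal k ≫ D.conjElt e hc hv z' := by
  subst hc hv
  have h : ∀ z, D.conjElt e rfl rfl z = (D.conj e (D.edgeUnitVal z) (D.mem_domE e rfl z)).2 :=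
    fun z => Category.comp_id _
  rw [h, h]
  rfl

/-- The unit `z` of the groupoid of `e` with `x = α_{bar e}(z)`. -/
def preUnit (e : D.Γ.Edge) (x : D.graphOfGroupoids.V (D.Γ.o e)) :
    D.graphOfGroupoids.E (D.Γ.geom e) :=
  (Equiv.ofBijective _ (D.graphOfGroupoids.mono_bijective (D.Γ.bar e) (SerreGraph.geom_bar e)
    (D.Γ.t_bar e))).symm x

theorem mono_preUnit (e : D.Γ.Edge) (x : D.graphOfGroupoids.V (D.Γ.o e)) :
    (D.graphOfGroupoids.mono (D.Γ.bar e) (SerreGraph.geom_bar e) (D.Γ.t_bar e)).obj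
      (D.preUnit e x) = x :=
  Equiv.ofBijective_apply_symm_apply _ (D.graphOfGroupoids.mono_bijective (D.Γ.bar e)
    (SerreGraph.geom_bar e) (D.Γ.t_bar e)) x

theorem preUnit_mono (e : D.Γ.Edge) (z : D.graphOfGroupoids.E (D.Γ.geom e)) :
    D.preUnit e ((D.graphOfGroupoids.mono (D.Γ.bar e) (SerreGraph.geom_bar e) (D.Γ.t_bar e)).obj
      z) = z :=
  Equiv.ofBijective_symm_apply_apply _ (D.graphOfGroupoids.mono_bijective (D.Γ.bar e)
    (SerreGraph.geom_bar e) (D.Γ.t_bar e)) z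

/-- The element `g_{e,x}` of `𝒢`, with source `x` and range `φₑ(x)`, for all edges `e` and all units
`x` of the groupoid of `o(e)`. It is the unit `x` if `e` belongs to `T`; otherwise it is
`conj e x` if `e` is negatively oriented, and `(conj (bar e) (φₑ(x)))⁻¹` if `e` is positively
oriented (as one of `conj e` and `conj (bar e)` is trivial). -/
def gElt (e : D.Γ.Edge) (x : D.graphOfGroupoids.V (D.Γ.o e)) :
    D.unitVal ⟨D.Γ.o e, x⟩ ⟶ D.unitVal ⟨D.Γ.t e, D.graphOfGroupoids.φ e x⟩ :=
  eqToHom (by rw [D.mono_preUnit e x]) ≫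
    Groupoid.inv (D.conjElt (D.Γ.bar e) (SerreGraph.geom_bar e) (D.Γ.t_bar e) (D.preUnit e x)) ≫
      D.conjElt e rfl rfl (D.preUnit e x)

theorem unitVal_φ (e : D.Γ.Edge) (he : e ∈ D.T.edges) (x : D.graphOfGroupoids.V (D.Γ.o e)) :
    D.unitVal ⟨D.Γ.t e, D.graphOfGroupoids.φ e x⟩ = D.unitVal ⟨D.Γ.o e, x⟩ := by
  have h1 : D.unitVal ⟨D.Γ.t e, D.graphOfGroupoids.φ e x⟩ = D.edgeUnitVal (D.preUnit e x) :=
    (D.unitVal_mono e rfl rfl (D.preUnit e x)).trans (by rw [D.conj_trivial e (Or.inl he)])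
  have h2 := D.unitVal_mono (D.Γ.bar e) (SerreGraph.geom_bar e) (D.Γ.t_bar e) (D.preUnit e x)
  rw [D.conj_trivial _ (Or.inl (D.T.bar_mem e he)), D.mono_preUnit] at h2
  rw [h1, h2]

theorem unitVal_phi (p : List D.T.edges) (y x : D.graphOfGroupoids.Units)
    (h : D.graphOfGroupoids.Phi (p.map Subtype.val) y x) : D.unitVal x = D.unitVal y := by
  induction p generalizing x with
  | nil => exact congrArg D.unitVal (show y = x from h).symm
  | cons e p ih =>
    obtain ⟨z, hz, rfl⟩ := h
    rw [D.unitVal_φ e.1 e.2, ih _ hz]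

/-- The map `ψ` on units: the inclusion of the units of the groupoid at the root. -/
def fundVal (a : D.graphOfGroupoids.FundUnit D.T) : 𝒢 := D.unitVal ⟨D.T.root, a.val⟩

theorem fundVal_tau (y : D.graphOfGroupoids.Units) :
    D.fundVal (D.graphOfGroupoids.tau D.T y) = D.unitVal y := by
  obtain ⟨p, -, h⟩ := D.graphOfGroupoids.tau_rel D.T y
  exact D.unitVal_phi p _ _ h

theorem fundVal_eq {v : D.Γ.Vert} {x : D.graphOfGroupoids.V v}
    {a : D.graphOfGroupoids.FundUnit D.T} (ha : D.graphOfGroupoids.tau D.T ⟨v, x⟩ = a) :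
    D.fundVal a = D.unitVal ⟨v, x⟩ := by
  rw [← ha, D.fundVal_tau]

/-- The map `ψ_∘` on arrows of vertex groupoids: `g ↦ g`. -/
def psiVert {v : D.Γ.Vert} {x y : D.graphOfGroupoids.V v} (g : x ⟶ y)
    {a b : D.graphOfGroupoids.FundUnit D.T} (ha : D.graphOfGroupoids.tau D.T ⟨v, x⟩ = a)
    (hb : D.graphOfGroupoids.tau D.T ⟨v, y⟩ = b) : D.fundVal a ⟶ D.fundVal b :=
  eqToHom (D.fundVal_eq ha) ≫ D.vertVal g ≫ eqToHom (D.fundVal_eq hb).symm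

/-- The map `ψ_∘` on the pairs `(φₑ(x), x)`: `(φₑ(x), x) ↦ g_{e,x}`. -/
def psiEdge (e : D.Γ.Edge) (x : D.graphOfGroupoids.V (D.Γ.o e))
    {a b : D.graphOfGroupoids.FundUnit D.T} (ha : D.graphOfGroupoids.tau D.T ⟨D.Γ.o e, x⟩ = a)
    (hb : D.graphOfGroupoids.tau D.T ⟨D.Γ.t e, D.graphOfGroupoids.φ e x⟩ = b) :
    D.fundVal a ⟶ D.fundVal b :=
  eqToHom (D.fundVal_eq ha) ≫ D.gElt e x ≫ eqToHom (D.fundVal_eq hb).symm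

/-- The map `ψ_∘` on the generators of the fundamental groupoid. -/
def psiGen : D.graphOfGroupoids.FundUnit D.T ⥤q 𝒢 where
  obj a := D.fundVal a
  map {a b} γ := match (γ : D.graphOfGroupoids.Gen D.T a b) with
    | .vert g ha hb => D.psiVert g ha hb
    | .edge e x ha hb => D.psiEdge e x ha hb

/-- The homomorphism defined by `ψ_∘` on the free groupoid on the generators. -/
def psiFree : D.graphOfGroupoids.FreeGpd D.T ⥤ 𝒢 := Quiver.FreeGroupoid.lift D.psiGen

theorem psiFree_vert {v : D.Γ.Vert} {x y : D.graphOfGroupoids.V v} (g : x ⟶ y)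
    {a b : D.graphOfGroupoids.FundUnit D.T} (ha : D.graphOfGroupoids.tau D.T ⟨v, x⟩ = a)
    (hb : D.graphOfGroupoids.tau D.T ⟨v, y⟩ = b) :
    D.psiFree.map (D.graphOfGroupoids.freeVert D.T g ha hb) = D.psiVert g ha hb :=
  Category.id_comp _

theorem psiFree_edge (e : D.Γ.Edge) (x : D.graphOfGroupoids.V (D.Γ.o e))
    {a b : D.graphOfGroupoids.FundUnit D.T} (ha : D.graphOfGroupoids.tau D.T ⟨D.Γ.o e, x⟩ = a)
    (hb : D.graphOfGroupoids.tau D.T ⟨D.Γ.t e, D.graphOfGroupoids.φ e x⟩ = b) :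
    D.psiFree.map (D.graphOfGroupoids.freeEdge D.T e x ha hb) = D.psiEdge e x ha hb :=
  Category.id_comp _

theorem gElt_eq (e : D.Γ.Edge) (x : D.graphOfGroupoids.V (D.Γ.o e))
    (z : D.graphOfGroupoids.E (D.Γ.geom e)) (hz : D.preUnit e x = z)
    (h₁ : D.unitVal ⟨D.Γ.o e, x⟩ = D.unitVal ⟨D.Γ.o e,
      (D.graphOfGroupoids.mono (D.Γ.bar e) (SerreGraph.geom_bar e) (D.Γ.t_bar e)).obj z⟩)
    (h₂ : D.unitVal ⟨D.Γ.t e, (D.graphOfGroupoids.mono e rfl rfl).obj z⟩ =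
      D.unitVal ⟨D.Γ.t e, D.graphOfGroupoids.φ e x⟩) :
    D.gElt e x = eqToHom h₁ ≫
      Groupoid.inv (D.conjElt (D.Γ.bar e) (SerreGraph.geom_bar e) (D.Γ.t_bar e) z) ≫
        D.conjElt e rfl rfl z ≫ eqToHom h₂ := by
  subst hz
  unfold gElt
  congr 1
  exact congrArg _ (Category.comp_id _).symm

theorem psiFree_edge' (e : D.Γ.Edge) {c : D.Γ.GeomEdge} (hc : D.Γ.geom e = c)
    (hc' : D.Γ.geom (D.Γ.bar e) = c) (z : D.graphOfGroupoids.E c)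
    {a b : D.graphOfGroupoids.FundUnit D.T}
    (ha : D.graphOfGroupoids.tau D.T ⟨D.Γ.o e,
      (D.graphOfGroupoids.mono (D.Γ.bar e) hc' (D.Γ.t_bar e)).obj z⟩ = a)
    (hb : D.graphOfGroupoids.tau D.T ⟨D.Γ.t e, (D.graphOfGroupoids.mono e hc rfl).obj z⟩ = b) :
    D.psiFree.map (D.graphOfGroupoids.freeEdge' D.T e hc hc' z ha hb) =
      eqToHom (D.fundVal_eq ha) ≫
        Groupoid.inv (D.conjElt (D.Γ.bar e) hc' (D.Γ.t_bar e) z) ≫ D.conjElt e hc rfl z ≫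
          eqToHom (D.fundVal_eq hb).symm := by
  subst hc
  refine (D.psiFree_edge e _ ha _).trans ?_
  rw [psiEdge, D.gElt_eq e _ z (D.preUnit_mono e z) rfl
      (by rw [D.graphOfGroupoids.φ_mono e rfl (SerreGraph.geom_bar e)])]
  simp only [eqToHom_refl, Category.id_comp, Category.assoc, eqToHom_trans]
  rfl

theorem psiVert_id {v : D.Γ.Vert} (x : D.graphOfGroupoids.V v)
    {a : D.graphOfGroupoids.FundUnit D.T} (ha : D.graphOfGroupoids.tau D.T ⟨v, x⟩ = a) :
    D.psiVert (𝟙 x) ha ha = 𝟙 (D.fundVal a) := by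
  have : D.vertVal (𝟙 x) = 𝟙 _ := rfl
  rw [psiVert, this, Category.id_comp, eqToHom_trans, eqToHom_refl]

theorem psiVert_comp {v : D.Γ.Vert} {x y z : D.graphOfGroupoids.V v} (g : x ⟶ y) (k : y ⟶ z)
    {a b c : D.graphOfGroupoids.FundUnit D.T} (ha : D.graphOfGroupoids.tau D.T ⟨v, x⟩ = a)
    (hb : D.graphOfGroupoids.tau D.T ⟨v, y⟩ = b) (hc : D.graphOfGroupoids.tau D.T ⟨v, z⟩ = c) :
    D.psiVert (g ≫ k) ha hc = D.psiVert g ha hb ≫ D.psiVert k hb hc := by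
  have : D.vertVal (g ≫ k) = D.vertVal g ≫ D.vertVal k := rfl
  rw [psiVert, psiVert, psiVert, this]
  simp only [Category.assoc, eqToHom_trans_assoc, eqToHom_refl, Category.id_comp]

theorem psi_r2 {c : D.Γ.GeomEdge} {z z' : D.graphOfGroupoids.E c} (g : z ⟶ z')
    (e e' : D.Γ.Edge) {f : D.Γ.Edge} (hf : e = f) {v v' w w' : D.Γ.Vert}
    (hc : D.Γ.geom e = c) (hv : D.Γ.t e = v) (hfc : D.Γ.geom f = c) (hfw : D.Γ.t f = w)
    (hc' : D.Γ.geom e' = c) (hv' : D.Γ.t e' = v') (hw' : D.Γ.t e' = w')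
    {a b a' b' : D.graphOfGroupoids.FundUnit D.T}
    (h₁ : D.fundVal a = D.unitVal ⟨w, (D.graphOfGroupoids.mono f hfc hfw).obj z⟩)
    (h₂ : D.fundVal a = D.unitVal ⟨v, (D.graphOfGroupoids.mono e hc hv).obj z⟩)
    (h₃ : D.fundVal a' = D.unitVal ⟨w', (D.graphOfGroupoids.mono e' hc' hw').obj z⟩)
    (h₄ : D.fundVal a' = D.unitVal ⟨v', (D.graphOfGroupoids.mono e' hc' hv').obj z⟩)
    (h₅ : D.fundVal b' = D.unitVal ⟨v', (D.graphOfGroupoids.mono e' hc' hv').obj z'⟩)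
    (h₆ : D.fundVal b = D.unitVal ⟨v, (D.graphOfGroupoids.mono e hc hv).obj z'⟩) :
    (eqToHom h₁ ≫ Groupoid.inv (D.conjElt f hfc hfw z) ≫ D.conjElt e' hc' hw' z ≫
        eqToHom h₃.symm) ≫
      (eqToHom h₄ ≫ D.vertVal ((D.graphOfGroupoids.mono e' hc' hv').map g) ≫ eqToHom h₅.symm) ≫
        (eqToHom h₅ ≫ Groupoid.inv (D.conjElt e' hc' hv' z') ≫ D.conjElt e hc hv z' ≫
          eqToHom h₆.symm) =
      eqToHom h₂ ≫ D.vertVal ((D.graphOfGroupoids.mono e hc hv).map g) ≫ eqToHom h₆.symm := by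
  subst hf hv hv' hfw hw'
  rw [D.vertVal_mono, D.vertVal_mono]
  simp

theorem psiFree_r1 (e : D.Γ.Edge) (he : e ∈ D.T.edges) (x : D.graphOfGroupoids.V (D.Γ.o e))
    {a : D.graphOfGroupoids.FundUnit D.T} (ha : D.graphOfGroupoids.tau D.T ⟨D.Γ.o e, x⟩ = a)
    (hb : D.graphOfGroupoids.tau D.T ⟨D.Γ.t e, D.graphOfGroupoids.φ e x⟩ = a) :
    D.psiEdge e x ha hb = 𝟙 (D.fundVal a) := by
  have key : ∀ (f : D.Γ.Edge) (hf : f ∈ D.T.edges) {c : D.Γ.GeomEdge} {v : D.Γ.Vert}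
      (hc : D.Γ.geom f = c) (hv : D.Γ.t f = v) (z : D.graphOfGroupoids.E c),
      ∃ h, D.conjElt f hc hv z = eqToHom h := by
    intro f hf c v hc hv z
    have h1 : ∀ (s : Σ y : 𝒢, (D.edgeUnitVal z ⟶ y)), s = ⟨D.edgeUnitVal z, 𝟙 _⟩ →
        ∃ h, s.2 = eqToHom h := by rintro _ rfl; exact ⟨rfl, rfl⟩
    obtain ⟨h, h2⟩ := h1 _ (D.conj_trivial f (Or.inl hf) _ (D.mem_domE f hc z))
    refine ⟨h.trans (D.unitVal_mono f hc hv z).symm, ?_⟩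
    rw [conjElt, h2, eqToHom_trans]
  obtain ⟨h, h1⟩ := key e he rfl rfl (D.preUnit e x)
  obtain ⟨k, k1⟩ := key (D.Γ.bar e) (D.T.bar_mem e he) (SerreGraph.geom_bar e) (D.Γ.t_bar e)
    (D.preUnit e x)
  have h2 : D.gElt e x = eqToHom (D.unitVal_φ e he x).symm := by
    rw [gElt, h1, k1, Groupoid.inv_eq_inv, inv_eqToHom]
    exact (congrArg (_ ≫ ·) (eqToHom_trans _ h)).trans (eqToHom_trans _ _)
  rw [psiEdge, h2, eqToHom_trans, eqToHom_trans, eqToHom_refl]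

theorem psiFree_rel (a b : D.graphOfGroupoids.FreeGpd D.T) (f₁ f₂ : a ⟶ b)
    (h : D.graphOfGroupoids.FundRel D.T f₁ f₂) : D.psiFree.map f₁ = D.psiFree.map f₂ := by
  cases h with
  | id x =>
    exact (D.psiFree_vert _ _ _).trans ((D.psiVert_id x rfl).trans (D.psiFree.map_id _).symm)
  | comp g k =>
    exact (D.psiFree_vert _ _ _).trans ((D.psiVert_comp g k _ rfl _).trans
      ((D.psiFree.map_comp _ _).trans (congrArg₂ (fun p q => p ≫ q) (D.psiFree_vert _ _ _)
        (D.psiFree_vert _ _ _))).symm)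
  | r1 e he x ha hb =>
    exact (D.psiFree_edge e x ha hb).trans
      ((D.psiFree_r1 e he x ha hb).trans (D.psiFree.map_id _).symm)
  | r2 e g =>
    rename_i z z'
    refine Eq.trans ((D.psiFree.map_comp _ _).trans (congrArg₂ (fun p q => p ≫ q)
      (D.psiFree_edge' _ _ _ _ _ _) ((D.psiFree.map_comp _ _).trans (congrArg₂ (fun p q => p ≫ q)
        (D.psiFree_vert _ _ _) (D.psiFree_edge' _ _ _ _ _ _))))) (Eq.trans ?_
          (D.psiFree_vert _ _ _).symm)
    exact D.psi_r2 g e (D.Γ.bar e) (D.Γ.bar_bar e).symm _ _ _ _ _ _ _ _ _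
      (D.fundVal_eq (congrArg (D.graphOfGroupoids.tau D.T)
        (D.graphOfGroupoids.unit_mono_eq rfl _ _ _ _ z))) _ _ (D.fundVal_eq rfl)

/-- The homomorphism `ψ` from the fundamental groupoid to `𝒢` defined by `ψ_∘`. -/
def psi : D.graphOfGroupoids.FundGpd D.T ⥤ 𝒢 :=
  CategoryTheory.Quotient.lift _ D.psiFree D.psiFree_rel

instance : Nonempty (D.graphOfGroupoids.FundUnit D.T) := by
  obtain ⟨w⟩ := F.nonempty_vert
  exact ⟨⟨⟨A.onVert.mom w, ((D.σ _).mem_objs_iff _).2 (by rw [D.dom_root]; trivial)⟩⟩⟩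

/-- The Bass–Serre forest of the graph of groupoids of a desingularization. -/
abbrev bassSerre : SerreGraph := D.graphOfGroupoids.bassSerre D.T D.P

/-- If `τ(y) = a`, for a unit `y` of the groupoid of `v`, then `σ v` is defined at `ψ(a)`. -/
theorem psi_mem_dom {v : D.Γ.Vert} {y : D.graphOfGroupoids.V v}
    {a : D.graphOfGroupoids.FundUnit D.T} (hs : D.graphOfGroupoids.tau D.T ⟨v, y⟩ = a) :
    D.psi.obj (D.graphOfGroupoids.fundUnit D.T a) ∈ (D.σ v).dom := by
  have h : D.psi.obj (D.graphOfGroupoids.fundUnit D.T a) = D.unitVal ⟨v, y⟩ := D.fundVal_eq hs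
  rw [h]
  exact D.mem_dom y

/-- If `τ(α_{|e|}(z)) = a`, for a unit `z` of the groupoid of `e`, then `σE e` is defined at
`ψ(a)`. -/
theorem psi_mem_domE {e : D.Γ.Edge} {z : D.graphOfGroupoids.E (D.Γ.geom (D.P.abs e))}
    {a : D.graphOfGroupoids.FundUnit D.T}
    (hs : D.graphOfGroupoids.tau D.T ⟨D.Γ.t (D.P.abs e),
      (D.graphOfGroupoids.mono (D.P.abs e) rfl rfl).obj z⟩ = a) :
    D.psi.obj (D.graphOfGroupoids.fundUnit D.T a) ∈ (D.σE e).dom := by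
  have h : D.psi.obj (D.graphOfGroupoids.fundUnit D.T a) = D.edgeUnitVal z := by
    refine (D.fundVal_eq hs).trans ((D.unitVal_mono (D.P.abs e) rfl rfl z).trans ?_)
    rw [D.conj_trivial _ (Or.inr (D.P.abs_mem e))]
  rw [h]
  exact D.mem_domE e (D.P.geom_abs e).symm z

end Desingularization

end

/-! Write $\gamma_{e,z}$ for the conjugating elements `conj`. Everything rests on two facts:
$\mathcal G_v$ and $\mathcal G_e$ are by definition the stabilizers of $\sigma_v$ and $\sigma_e$,
and $\gamma_e$ is trivial on positive edges.

Well-definedness on vertices: for $g\in\mathcal G_v$,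
$\psi(pg)\,\sigma_v(s(g))=\psi(p)\,g\,\sigma_v(s(g))=\psi(p)\,\sigma_v(r(g))$ (`act_psiVert`,
`vertImage_eq_of_rel`). On edges, $\alpha_{|e|}$ is an inclusion because $|e|$ is positive, so an
element of $\mathcal H_{|e|}$ is an element of $\mathcal G_e$, and it stabilizes $\sigma_e$ and
$\sigma_{\bar e}$ alike (`psiVert_mono_of_pos`, `act_edgeVal`, `edgeImage_eq_of_rel`).

Origins: inverting $\gamma_{\bar e,z}\,t(\sigma_{\bar e}(z))=\sigma_{o(e)}(r(\gamma_{\bar e,z}))$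
shows that $\gamma_{\bar e,z}^{-1}$ carries the section at $o(e)$ to $o(\sigma_e(z))$
(`act_inv_conjElt_bar`). If $e$ is positive, the origin is $p\,e$, and
$\psi(e)=\gamma_{e,z}\gamma_{\bar e,z}^{-1}=\gamma_{\bar e,z}^{-1}$ does what is needed; if $e$ is
negative, the origin is $p$ and $\gamma_{\bar e,z}$ is trivial (`vertImage_origin`). Termini follow
by reversing edges (`edgeImage_bar`). Equivariance is functoriality of $\psi$ together with
associativity of the action, and $\Psi$ is unique because every vertex and every edge is a coset.

The units $\psi(\tau(y))$ and $y$ are equal by a theorem and not by definition, so the arrows carry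
factors `eqToHom`; these only move a section from one name of a unit to another. -/

/-! ### Actions of products and of identifications of units -/

theorem PartialSection.act_eqToHom {𝒢 : Type u₁} [Groupoid.{v₁} 𝒢] {X : Type w₁}
    {B : GroupoidAction 𝒢 X} (σ : PartialSection B) {x y : 𝒢} (h : x = y) (hx : x ∈ σ.dom)
    (hy : y ∈ σ.dom) :
    B.act (eqToHom h) (σ.toFun x hx) (σ.mom_toFun x hx) = σ.toFun y hy := by
  subst h
  exact B.act_id' _ _

/-- Applies a product one factor at a time: the point reached after `g` gets a name `b` of its own,
so a known value such as that of a section can be substituted before `k` acts. -/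
theorem GroupoidAction.act_comp_of_eq {𝒢 : Type u₁} [Groupoid.{v₁} 𝒢] {X : Type w₁}
    (B : GroupoidAction 𝒢 X) {x y z : 𝒢} (g : x ⟶ y) (k : y ⟶ z) {a b : X}
    (ha : B.mom a = x) (hb : B.mom b = y) (h : B.act g a ha = b) :
    B.act (g ≫ k) a ha = B.act k b hb := by
  subst h
  exact (B.act_act g k a ha).symm

/-- Replaces an arrow by unification, since endpoints such as `psi.obj (fundUnit a)` and `fundVal a`
agree only after unfolding. -/
theorem GroupoidAction.act_hom_congr {𝒢 : Type u₁} [Groupoid.{v₁} 𝒢] {X : Type w₁}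
    (B : GroupoidAction 𝒢 X) {x y : 𝒢} {g k : x ⟶ y} (h : g = k) (a : X) (ha : B.mom a = x) :
    B.act g a ha = B.act k a ha := by
  rw [h]

namespace Desingularization

variable {𝒢 : Type u₁} [Groupoid.{v₁} 𝒢] {F : SerreGraph.{w₃, w₄}} {A : ForestAction 𝒢 F}
  (D : Desingularization.{w₁, w₂} A)

/-! ### Conjugating families, and $\psi$ on generators -/

/-- On positive edges `conj` is the identity, so only the identification of $z$ with $\alpha_e(z)$
remains. The existential also delivers this equality of units. -/
theorem conjElt_eq_eqToHom {e : D.Γ.Edge} (he : e ∈ D.P.pos) {c : D.Γ.GeomEdge} {v : D.Γ.Vert}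
    (hc : D.Γ.geom e = c) (hv : D.Γ.t e = v) (z : D.graphOfGroupoids.E c) :
    ∃ h, D.conjElt e hc hv z = eqToHom h := by
  -- The range of `conj` is a component of the pair, so the arrow cannot be replaced alone; a
  -- variable pair `s` allows the equality to be eliminated.
  have h1 : ∀ s : Σ y : 𝒢, (D.edgeUnitVal z ⟶ y), s = ⟨D.edgeUnitVal z, 𝟙 _⟩ →
      ∃ h, s.2 = eqToHom h := by rintro _ rfl; exact ⟨rfl, rfl⟩
  obtain ⟨h, h2⟩ := h1 _ (D.conj_trivial e (Or.inr he) _ (D.mem_domE e hc z))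
  exact ⟨h.trans (D.unitVal_mono e hc hv z).symm, by rw [conjElt, h2, eqToHom_trans]⟩

theorem act_conjElt (e : D.Γ.Edge) {c : D.Γ.GeomEdge} {v : D.Γ.Vert} (hc : D.Γ.geom e = c)
    (hv : D.Γ.t e = v) (z : D.graphOfGroupoids.E c) :
    A.onVert.act (D.conjElt e hc hv z) (F.t ((D.σE e).toFun _ (D.mem_domE e hc z)))
        ((A.mom_t _).trans ((D.σE e).mom_toFun _ _)) =
      (D.σ v).toFun _ (D.mem_dom ((D.graphOfGroupoids.mono e hc hv).obj z)) := by
  subst hc hv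
  -- With `c` and `v` substituted, the `eqToHom` inside `conjElt` is an identity by definition.
  refine (A.onVert.act_hom_congr (Category.comp_id _) _ _).trans ?_
  exact D.conj_act e _ (D.mem_domE e rfl z)

theorem psi_vertArr {v : D.Γ.Vert} {x y : D.graphOfGroupoids.V v} (g : x ⟶ y)
    {a b : D.graphOfGroupoids.FundUnit D.T} (ha : D.graphOfGroupoids.tau D.T ⟨v, x⟩ = a)
    (hb : D.graphOfGroupoids.tau D.T ⟨v, y⟩ = b) :
    D.psi.map (D.graphOfGroupoids.vertArr D.T g ha hb) = D.psiVert g ha hb :=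
  D.psiFree_vert g ha hb

theorem psi_edgeArr (e : D.Γ.Edge) {c : D.Γ.GeomEdge} (hc : D.Γ.geom e = c)
    (hc' : D.Γ.geom (D.Γ.bar e) = c) (z : D.graphOfGroupoids.E c)
    {a b : D.graphOfGroupoids.FundUnit D.T}
    (ha : D.graphOfGroupoids.tau D.T ⟨D.Γ.o e,
      (D.graphOfGroupoids.mono (D.Γ.bar e) hc' (D.Γ.t_bar e)).obj z⟩ = a)
    (hb : D.graphOfGroupoids.tau D.T ⟨D.Γ.t e, (D.graphOfGroupoids.mono e hc rfl).obj z⟩ = b) :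
    D.psi.map (D.graphOfGroupoids.edgeArr D.T e hc hc' z ha hb) =
      eqToHom (D.fundVal_eq ha) ≫
        Groupoid.inv (D.conjElt (D.Γ.bar e) hc' (D.Γ.t_bar e) z) ≫ D.conjElt e hc rfl z ≫
          eqToHom (D.fundVal_eq hb).symm :=
  D.psiFree_edge' e hc hc' z ha hb

/-- As $\alpha_f$ is an inclusion for positive $f$, the source of a representative $p$ of an edge
is, inside $\mathcal G$, the unit $z$ itself. Hence $\sigma_e(\psi(s(p)))$ is $\sigma_e(z)$. -/
theorem fundVal_eq_edgeUnitVal {f : D.Γ.Edge} (hf : f ∈ D.P.pos) {c : D.Γ.GeomEdge}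
    {v : D.Γ.Vert} (hc : D.Γ.geom f = c) (hv : D.Γ.t f = v) {z : D.graphOfGroupoids.E c}
    {a : D.graphOfGroupoids.FundUnit D.T}
    (hs : D.graphOfGroupoids.tau D.T ⟨v, (D.graphOfGroupoids.mono f hc hv).obj z⟩ = a) :
    D.fundVal a = D.edgeUnitVal z :=
  (D.fundVal_eq hs).trans (D.conjElt_eq_eqToHom hf hc hv z).choose.symm

/-- Up to identifications of units `psiVert g` is $g$, which stabilizes $\sigma_v$. This is the
invariance behind $\Psi^0$. -/
theorem act_psiVert {v : D.Γ.Vert} {x y : D.graphOfGroupoids.V v} (g : x ⟶ y)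
    {a b : D.graphOfGroupoids.FundUnit D.T} (ha : D.graphOfGroupoids.tau D.T ⟨v, x⟩ = a)
    (hb : D.graphOfGroupoids.tau D.T ⟨v, y⟩ = b) :
    A.onVert.act (D.psiVert g ha hb) ((D.σ v).toFun _ (D.psi_mem_dom ha))
        ((D.σ v).mom_toFun _ _) =
      (D.σ v).toFun _ (D.psi_mem_dom hb) := by
  obtain ⟨hx, hy, hg⟩ := g.2
  -- The three factors of `psiVert g` move the section from $\psi(a)$ to $x$, then by $g$ to $y$,
  -- then to $\psi(b)$.
  refine (A.onVert.act_comp_of_eq _ _ _ ((D.σ v).mom_toFun _ hx)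
    ((D.σ v).act_eqToHom (D.fundVal_eq ha) _ hx)).trans ?_
  refine (A.onVert.act_comp_of_eq _ _ _ ((D.σ v).mom_toFun _ hy) hg).trans ?_
  exact (D.σ v).act_eqToHom _ hy _

/-- Arrows of edge groupoids stabilize the sections of all edges with the same geometric edge. -/
theorem act_edgeVal (e : D.Γ.Edge) {c : D.Γ.GeomEdge} (hc : D.Γ.geom e = c)
    {z z' : D.graphOfGroupoids.E c} (k : z ⟶ z') :
    A.onEdge.act (D.edgeVal k) ((D.σE e).toFun _ (D.mem_domE e hc z))
        ((D.σE e).mom_toFun _ _) =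
      (D.σE e).toFun _ (D.mem_domE e hc z') := by
  -- For `c` equal to `geom e`, `edgeStab c` unfolds to the stabilizer of `σE e`, whichever of the
  -- two orientations `e` is.
  subst hc
  obtain ⟨_, _, hk⟩ := k.2
  exact hk

/-- Both conjugating factors of $\alpha_f(k)$ are trivial for positive $f$, so $\psi$ sends
$\alpha_f(k)$ to $k$. It is applied to $f=|e|$. -/
theorem psiVert_mono_of_pos {f : D.Γ.Edge} (hf : f ∈ D.P.pos)
    {z z' : D.graphOfGroupoids.E (D.Γ.geom f)} (k : z ⟶ z')
    {a b : D.graphOfGroupoids.FundUnit D.T}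
    (ha : D.graphOfGroupoids.tau D.T ⟨D.Γ.t f, (D.graphOfGroupoids.mono f rfl rfl).obj z⟩ = a)
    (hb : D.graphOfGroupoids.tau D.T ⟨D.Γ.t f, (D.graphOfGroupoids.mono f rfl rfl).obj z'⟩ = b) :
    D.psiVert ((D.graphOfGroupoids.mono f rfl rfl).map k) ha hb =
      eqToHom (D.fundVal_eq_edgeUnitVal hf rfl rfl ha) ≫ D.edgeVal k ≫
        eqToHom (D.fundVal_eq_edgeUnitVal hf rfl rfl hb).symm := by
  obtain ⟨h, h1⟩ := D.conjElt_eq_eqToHom hf rfl rfl z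
  obtain ⟨h', h1'⟩ := D.conjElt_eq_eqToHom hf rfl rfl z'
  rw [psiVert, D.vertVal_mono, h1, h1', Groupoid.inv_eq_inv, inv_eqToHom]
  simp only [Category.assoc, eqToHom_trans, eqToHom_trans_assoc]

/-! ### The images of cosets are well defined -/

/-- The separate name `f` for $|e|$ matches the fields of `EdgeRep`. -/
theorem psi_mem_domE' {e f : D.Γ.Edge} (hf : f = D.P.abs e)
    {z : D.graphOfGroupoids.E (D.Γ.geom f)} {a : D.graphOfGroupoids.FundUnit D.T}
    (hs : D.graphOfGroupoids.tau D.T ⟨D.Γ.t f,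
      (D.graphOfGroupoids.mono f rfl rfl).obj z⟩ = a) :
    D.psi.obj (D.graphOfGroupoids.fundUnit D.T a) ∈ (D.σE e).dom := by
  subst hf
  exact D.psi_mem_domE hs

/-- The image `ψ(p) σ_v(ψ(s(p)))` of a representative of the coset `p 𝒢_v [v]`. -/
noncomputable def vertImage (R : D.graphOfGroupoids.VertRep D.T) : F.Vert :=
  A.onVert.act (D.psi.map R.p) ((D.σ R.v).toFun _ (D.psi_mem_dom R.hs))
    ((D.σ R.v).mom_toFun _ _)

/-- The image `ψ(p) σ_e(ψ(s(p)))` of a representative of the coset `p ℋ_{|e|} [e]`. -/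
noncomputable def edgeImage (R : D.graphOfGroupoids.EdgeRep D.T D.P) : F.Edge :=
  A.onEdge.act (D.psi.map R.p) ((D.σE R.e).toFun _ (D.psi_mem_domE' R.hf R.hs))
    ((D.σE R.e).mom_toFun _ _)

/-- After splitting $\psi(pg)$ as $\psi(p)\psi(g)$, the factor $\psi(g)$ is absorbed by the section.
-/
theorem vertImage_eq_of_rel {R S : D.graphOfGroupoids.VertRep D.T}
    (h : D.graphOfGroupoids.VertRel D.T R S) : D.vertImage R = D.vertImage S := by
  obtain ⟨g, hx, hy, p⟩ := h
  refine (A.onVert.act_hom_congr (D.psi.map_comp _ _) _ _).trans ?_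
  refine A.onVert.act_comp_of_eq _ _ _ _ ?_
  exact (A.onVert.act_hom_congr (D.psi_vertArr g hx hy) _ _).trans (D.act_psiVert g hx hy)

/-- The coset is taken with respect to $\alpha_{|e|}$ while the section is $\sigma_e$. This is
harmless: $\psi(\alpha_{|e|}(k))$ is $k$, and $k$ stabilizes the sections of both orientations. -/
theorem edgeImage_eq_of_rel {R S : D.graphOfGroupoids.EdgeRep D.T D.P}
    (h : D.graphOfGroupoids.EdgeRel D.T D.P R S) : D.edgeImage R = D.edgeImage S := by
  obtain ⟨hf, k, hz, hz', p⟩ := h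
  rename_i e f z z' a' a b
  have hfp : f ∈ D.P.pos := hf ▸ D.P.abs_mem e
  have hc : D.Γ.geom e = D.Γ.geom f := by rw [hf, D.P.geom_abs]
  refine (A.onEdge.act_hom_congr (D.psi.map_comp _ _) _ _).trans ?_
  refine A.onEdge.act_comp_of_eq _ _ _ _ ?_
  refine (A.onEdge.act_hom_congr
    ((D.psi_vertArr _ hz hz').trans (D.psiVert_mono_of_pos hfp k hz hz')) _ _).trans ?_
  -- The section moves from $\psi(a')$ to $z$, then by $k$ to $z'$, then to $\psi(a)$.
  refine (A.onEdge.act_comp_of_eq _ _ _ ((D.σE e).mom_toFun _ (D.mem_domE e hc z))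
    ((D.σE e).act_eqToHom _ _ _)).trans ?_
  refine (A.onEdge.act_comp_of_eq _ _ _ ((D.σE e).mom_toFun _ (D.mem_domE e hc z'))
    (D.act_edgeVal e hc k)).trans ?_
  exact (D.σE e).act_eqToHom _ _ _

/-! ### Compatibility with reversal, origins and termini -/

/-- Reversal keeps $p$ and replaces $\sigma_e$ by $\sigma_{\bar e}=\overline{\sigma_e}$. The action
commutes with reversal because an edge of a forest is determined by its endpoints (`act_bar`). -/
theorem edgeImage_bar (R : D.graphOfGroupoids.EdgeRep D.T D.P) :
    D.edgeImage R.bar = F.bar (D.edgeImage R) := by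
  have h := D.σE_bar R.e _ (D.psi_mem_domE' R.hf R.hs) (D.psi_mem_domE' R.bar.hf R.bar.hs)
  refine (A.onEdge.act_congr (D.psi.map R.p) h _).trans ?_
  exact A.act_bar _ _ _ _

/-- This is `act_conjElt` for $\bar e$, inverted, combined with
$t(\overline{\sigma_e(z)})=o(\sigma_e(z))$. -/
theorem act_inv_conjElt_bar (e : D.Γ.Edge) {c : D.Γ.GeomEdge} (hc : D.Γ.geom e = c)
    (hc' : D.Γ.geom (D.Γ.bar e) = c) (z : D.graphOfGroupoids.E c) :
    A.onVert.act (Groupoid.inv (D.conjElt (D.Γ.bar e) hc' (D.Γ.t_bar e) z))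
        ((D.σ (D.Γ.o e)).toFun _
          (D.mem_dom ((D.graphOfGroupoids.mono (D.Γ.bar e) hc' (D.Γ.t_bar e)).obj z)))
        ((D.σ _).mom_toFun _ _) =
      F.o ((D.σE e).toFun _ (D.mem_domE e hc z)) := by
  refine (A.onVert.act_inv _ _ _ (D.act_conjElt (D.Γ.bar e) hc' (D.Γ.t_bar e) z)).trans ?_
  rw [D.σE_bar e _ (D.mem_domE e hc z), F.t_bar]

theorem act_eqToHom_origin (e : D.Γ.Edge) {x y : 𝒢} (h : x = y) (hx : x ∈ (D.σE e).dom)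
    (hy : y ∈ (D.σE e).dom) :
    A.onVert.act (eqToHom h) (F.o ((D.σE e).toFun x hx))
        ((A.mom_o _).trans ((D.σE e).mom_toFun x hx)) =
      F.o ((D.σE e).toFun y hy) := by
  subst h
  exact A.onVert.act_id' _ _

/-- Of $\gamma_e$ and $\gamma_{\bar e}$ the one on the positive edge is trivial. The exponent
$1-\varepsilon(e)$ inserts $e$ exactly when $\gamma_{\bar e}$ may be nontrivial and has to be
undone. -/
theorem vertImage_origin (R : D.graphOfGroupoids.EdgeRep D.T D.P) :
    D.vertImage R.origin = F.o (D.edgeImage R) := by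
  have hfp : R.f ∈ D.P.pos := R.hf ▸ D.P.abs_mem R.e
  have hU := D.fundVal_eq_edgeUnitVal hfp rfl rfl R.hs
  have hdom := D.mem_dom ((D.graphOfGroupoids.mono (D.Γ.bar R.e) R.geom_bar_e
    (D.Γ.t_bar R.e)).obj R.z)
  -- As $o$ commutes with the action, $\psi(p)$ can be split off on the right-hand side; what must
  -- be reached is $o(\sigma_e(\psi(s(p))))$.
  refine Eq.trans ?_ (A.o_act _ _ _).symm
  by_cases he : R.e ∈ D.P.pos
  · rw [show R.origin = _ from dif_pos he]
    refine (A.onVert.act_hom_congr (D.psi.map_comp _ _) _ _).trans ?_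
    refine A.onVert.act_comp_of_eq _ _ _ _ ?_
    -- It remains to follow $\psi(e)=\gamma_{e,z}\gamma_{\bar e,z}^{-1}$: an identification of
    -- units, then $\gamma_{\bar e,z}^{-1}$, which leads to $o(\sigma_e(z))$.
    refine (A.onVert.act_hom_congr (D.psi_edgeArr _ _ _ _ _ _) _ _).trans ?_
    refine (A.onVert.act_comp_of_eq _ _ _ ((D.σ _).mom_toFun _ hdom)
      ((D.σ _).act_eqToHom _ _ _)).trans ?_
    refine (A.onVert.act_comp_of_eq _ _ _ ((A.mom_o _).trans ((D.σE R.e).mom_toFun _ _))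
      (D.act_inv_conjElt_bar R.e R.geom_e R.geom_bar_e R.z)).trans ?_
    -- The remaining factor $\gamma_{e,z}$ is an identification since $e$ is positive; it merges
    -- with the final one.
    obtain ⟨h, h1⟩ := D.conjElt_eq_eqToHom he R.geom_e rfl R.z
    refine (A.onVert.act_hom_congr
      ((congrArg (· ≫ _) h1).trans (eqToHom_trans _ _)) _ _).trans ?_
    exact D.act_eqToHom_origin R.e hU.symm _ _
  · rw [show R.origin = _ from dif_neg he]
    have hbar : D.Γ.bar R.e ∈ D.P.pos := R.f_eq_bar he ▸ hfp
    -- Here the origin is represented by $p$ itself, so the two points to which $\psi(p)$ is applied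
    -- must agree. As $\bar e$ is positive, `act_inv_conjElt_bar` says that they do, up to the name
    -- of the unit.
    refine A.onVert.act_congr (D.psi.map R.p) ?_ _
    obtain ⟨h, h1⟩ := D.conjElt_eq_eqToHom hbar R.geom_bar_e (D.Γ.t_bar R.e) R.z
    have h2 := D.act_inv_conjElt_bar R.e R.geom_e R.geom_bar_e R.z
    rw [h1, Groupoid.inv_eq_inv, inv_eqToHom] at h2
    refine Eq.trans ?_ (D.act_eqToHom_origin R.e hU.symm (D.mem_domE R.e R.geom_e R.z) _)
    refine Eq.trans ?_ (A.onVert.act_comp_of_eq _ _ ((D.σ _).mom_toFun _ hdom) _ h2)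
    refine Eq.trans ?_ (A.onVert.act_hom_congr (eqToHom_trans _ _).symm _ _)
    exact ((D.σ _).act_eqToHom _ hdom _).symm

/-- The homomorphism `Ψ` from the Bass–Serre forest to `F`. -/
noncomputable def bassSerreHom : D.bassSerre.Hom F where
  onVert := Quot.lift D.vertImage fun _ _ => D.vertImage_eq_of_rel
  onEdge := Quot.lift D.edgeImage fun _ _ => D.edgeImage_eq_of_rel
  map_o := by
    rintro ⟨R⟩
    exact D.vertImage_origin R
  map_t := by
    rintro ⟨R⟩
    change D.vertImage R.terminus = F.t (D.edgeImage R)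
    -- The terminus of an edge is the origin of its reversal, which reduces the claim to
    -- `vertImage_origin` for `R.bar`.
    rw [← R.bar_bar, GraphOfGroupoids.EdgeRep.terminus_bar, D.vertImage_origin,
      D.edgeImage_bar R.bar, F.t_bar]
  map_bar := by
    rintro ⟨R⟩
    exact D.edgeImage_bar R

/-! ### Equivariance and uniqueness -/

/-- The middle identity is the `eqToHom` that `VertRep.mul` and `EdgeRep.mul` insert between the two
arrows. -/
theorem psi_map_comp_id_comp {a b c : D.graphOfGroupoids.FundGpd D.T} (p : a ⟶ b) (q : b ⟶ c) :
    D.psi.map (p ≫ 𝟙 b ≫ q) = D.psi.map p ≫ D.psi.map q := by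
  rw [Category.id_comp, D.psi.map_comp]

theorem bassSerreHom_isEquivariant : IsEquivariant D.psi
    (D.graphOfGroupoids.bassSerreAction D.T D.P) A.toGraphAction D.bassSerreHom where
  mom_vert := by
    rintro ⟨R⟩
    exact A.onVert.mom_act _ _ _
  mom_edge := by
    rintro ⟨R⟩
    exact A.onEdge.mom_act _ _ _
  act_vert := by
    rintro a b p ⟨R⟩ h
    -- Making the source of `p` literally the range of `R.p` turns that `eqToHom` into an identity.
    cases h
    exact (A.onVert.act_hom_congr (D.psi_map_comp_id_comp R.p p) _ _).trans (A.onVert.act_act _ _ _ _).symm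
  act_edge := by
    rintro a b p ⟨R⟩ h
    cases h
    exact (A.onEdge.act_hom_congr (D.psi_map_comp_id_comp R.p p) _ _).trans (A.onEdge.act_act _ _ _ _).symm

end Desingularization

/-- Well-definedness is expressed as existence: the formulas are required for every representative
of each coset. -/
theorem proposition8p3 {𝒢 : Type u₁} [Groupoid.{v₁} 𝒢] {F : SerreGraph.{w₃, w₄}}
    (A : ForestAction 𝒢 F) (D : Desingularization.{w₁, w₂} A) :
    ∃! Ψ : D.bassSerre.Hom F,
      (∀ (v : D.Γ.Vert) (y : D.graphOfGroupoids.V v) {a b : D.graphOfGroupoids.FundUnit D.T}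
          (hs : D.graphOfGroupoids.tau D.T ⟨v, y⟩ = a)
          (p : D.graphOfGroupoids.fundUnit D.T a ⟶ D.graphOfGroupoids.fundUnit D.T b),
        Ψ.onVert (D.graphOfGroupoids.vertCoset D.T v y hs p) =
          A.onVert.act (D.psi.map p) ((D.σ v).toFun (D.psi.obj _) (D.psi_mem_dom hs))
            ((D.σ v).mom_toFun _ _)) ∧
      (∀ (e : D.Γ.Edge) (z : D.graphOfGroupoids.E (D.Γ.geom (D.P.abs e)))
          {a b : D.graphOfGroupoids.FundUnit D.T}
          (hs : D.graphOfGroupoids.tau D.T ⟨D.Γ.t (D.P.abs e),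
            (D.graphOfGroupoids.mono (D.P.abs e) rfl rfl).obj z⟩ = a)
          (p : D.graphOfGroupoids.fundUnit D.T a ⟶ D.graphOfGroupoids.fundUnit D.T b),
        Ψ.onEdge (D.graphOfGroupoids.edgeCoset D.T D.P e z hs p) =
          A.onEdge.act (D.psi.map p) ((D.σE e).toFun (D.psi.obj _) (D.psi_mem_domE hs))
            ((D.σE e).mom_toFun _ _)) ∧
      IsEquivariant D.psi (D.graphOfGroupoids.bassSerreAction D.T D.P) A.toGraphAction Ψ := by
  refine ⟨D.bassSerreHom, ⟨fun _ _ _ _ _ _ => rfl, fun _ _ _ _ _ _ => rfl,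
    D.bassSerreHom_isEquivariant⟩, ?_⟩
  rintro Ψ ⟨hv, he, -⟩
  apply SerreGraph.Hom.ext
  · funext w
    obtain ⟨R⟩ := w
    exact hv R.v R.y R.hs R.p
  · funext f
    -- The pattern `rfl` replaces the name of $|e|$ by `D.P.abs e`, the form of the representatives
    -- in `edgeCoset`.
    obtain ⟨e, f, rfl, z, a, b, hs, p⟩ := f
    exact he e z hs p
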